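/- Write $\chi(x)=e^{-2\pi i\,x\cdot\chi}$ for $x,\chi\in\mathbb R^d$. A set $\Lambda\subset\mathbb R^d$ is a Meyer set if it is relatively dense and $\Lambda-\Lambda$ is uniformly discrete; a Delone set is a relatively dense, uniformly discrete set. For $S\subset\mathbb R^d$ and $\epsilon>0$ put $S^\epsilon=\{\chi\in\mathbb R^d : |1-\chi(x)|\le\epsilon \text{ for all } x\in S\}$. Fix a van Hove sequence $(B_n)$ in $\mathbb R^d$, i.e. a sequence of bounded Borel sets of positive volume with $\mathrm{Vol}(\partial^K B_n)/\mathrm{Vol}(B_n)\to 0$ for every compact $K$, where $\partial^K A=((A+K)\setminus A^\circ)\cup((\overline{\mathbb R^d\setminus A}-K)\cap A)$, and put $$\underline{\mathrm{dens}}(S)=\liminf_{n\to\infty}\inf_{x\in\mathbb R^d}\frac{\sharp(S\cap(x+B_n))}{\mathrm{Vol}(B_n)},\qquad \overline{\mathrm{dens}}(S)=\limsup_{n\to\infty}\sup_{x\in\mathbb R^d}\frac{\sharp(S\cap(x+B_n))}{\mathrm{Vol}(B_n)}.$$ For a Delone set $\Gamma$, an autocorrelation of $\Gamma$ is any cluster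 point $\gamma$, in the vague topology, of the sequence of measures $\gamma_n=\frac{1}{\mathrm{Vol}(B_n)}\,\delta_{\Gamma\cap B_n}*\widetilde{\delta_{\Gamma\cap B_n}}=\frac{1}{\mathrm{Vol}(B_n)}\sum_{x,y\in\Gamma\cap B_n}\delta_{x-y}$. Its Fourier transform $\widehat\gamma$ (in the sense of tempered distributions) is the corresponding diffraction measure, and the Bragg spectrum is $\{\chi\in\mathbb R^d:\widehat\gamma(\{\chi\})\ne 0\}$. **Theorem.** Let $\Lambda\subset\mathbb R^d$ be a Meyer set, $\Delta=\Lambda-\Lambda$, and let $\Gamma\subset\mathbb R^d$ be a Delone set. If $$\overline{\mathrm{dens}}(\Lambda\bigtriangleup\Gamma)<\frac{\sqrt2\,\underline{\mathrm{dens}}(\Lambda)-\overline{\mathrm{dens}}(\Lambda)}{\sqrt2+1},$$ then there exists $\epsilon>0$ such that for every autocorrelation $\gamma$ of $\Gamma$ (along $(B_n)$) the Fourier transform $\widehat\gamma$ exists as a positive measure and $\Delta^\epsilon$ is a subset of the Bragg spectrum: $\widehat\gamma(\{\chi\})\neq 0$ for all $\chi\in\Delta^\epsilon$. -/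

import Mathlib

open MeasureTheory Filter Topology Metric
open scoped NNReal ENNReal Pointwise FourierTransform SchwartzMap MeasureTheory
open scoped CompactlySupported

noncomputable section

namespace MeyerDiffraction

variable {d : ℕ}

/-! ### Point sets -/

/-- Distinct points of `S` are at distance bounded below by a positive constant. -/
def UniformlyDiscrete (S : Set (EuclideanSpace ℝ (Fin d))) : Prop :=
  ∃ r : ℝ≥0, 0 < r ∧ IsSeparated r S

/-- Every point of the space lies within a fixed distance of `S`. -/
def RelativelyDense (S : Set (EuclideanSpace ℝ (Fin d))) : Prop :=
  ∃ R : ℝ≥0, IsCover R Set.univ S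

/-- A Meyer set: `Λ` is relatively dense and `Λ - Λ` is uniformly discrete. -/
structure IsMeyer (Λ : Set (EuclideanSpace ℝ (Fin d))) : Prop where
  relativelyDense : RelativelyDense Λ
  uniformlyDiscrete_sub : UniformlyDiscrete (Λ - Λ)

/-- The character `χ(x) = exp (-2 π i x · χ)` of `ℝ^d` attached to `χ ∈ ℝ^d`. -/
def character (χ x : EuclideanSpace ℝ (Fin d)) : ℂ :=
  Complex.exp (-2 * Real.pi * Complex.I * (inner ℝ x χ : ℝ))

/-- The `ε`-dual set `S^ε`: all `χ` with `|1 - χ(x)| ≤ ε` for every `x ∈ S`. -/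
def epsDual (S : Set (EuclideanSpace ℝ (Fin d))) (ε : ℝ) :
    Set (EuclideanSpace ℝ (Fin d)) :=
  {χ | ∀ x ∈ S, ‖1 - character χ x‖ ≤ ε}

/-! ### Van Hove sequences and densities -/

/-- The `K`-boundary `∂^K A = ((A + K) \ A°) ∪ ((closure (ℝ^d \ A) - K) ∩ A)`. -/
def vanHoveBoundary (K A : Set (EuclideanSpace ℝ (Fin d))) :
    Set (EuclideanSpace ℝ (Fin d)) :=
  ((A + K) \ interior A) ∪ ((closure Aᶜ - K) ∩ A)

/-- A van Hove sequence: bounded Borel sets of positive volume such that, for each compact `K`,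
the volume of the `K`-boundary is asymptotically negligible. -/
structure IsVanHove (B : ℕ → Set (EuclideanSpace ℝ (Fin d))) : Prop where
  measurableSet : ∀ n, MeasurableSet (B n)
  isBounded : ∀ n, Bornology.IsBounded (B n)
  volume_pos : ∀ n, 0 < volume (B n)
  tendsto_boundary : ∀ K : Set (EuclideanSpace ℝ (Fin d)), IsCompact K →
    Tendsto (fun n => volume (vanHoveBoundary K (B n)) / volume (B n)) atTop (𝓝 0)

/-- `#(S ∩ (x + B)) / Vol B`, as an extended nonnegative number. -/
def relFrequency (S B : Set (EuclideanSpace ℝ (Fin d))) (x : EuclideanSpace ℝ (Fin d)) :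
    ℝ≥0∞ :=
  ((S ∩ (x +ᵥ B)).encard : ℝ≥0∞) / volume B

/-- The lower density of `S` along `B`. It is computed in `[0, ∞]`, so that no boundedness is
needed for the definition to make sense. -/
def lowerDensity (B : ℕ → Set (EuclideanSpace ℝ (Fin d)))
    (S : Set (EuclideanSpace ℝ (Fin d))) : ℝ≥0∞ :=
  liminf (fun n => ⨅ x, relFrequency S (B n) x) atTop

/-- The upper density of `S` along `B`, computed in `[0, ∞]`. -/
def upperDensity (B : ℕ → Set (EuclideanSpace ℝ (Fin d)))
    (S : Set (EuclideanSpace ℝ (Fin d))) : ℝ≥0∞ :=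
  limsup (fun n => ⨆ x, relFrequency S (B n) x) atTop

/-! ### Autocorrelation and diffraction -/

/-- The Dirac comb `δ_S = ∑_{x ∈ S} δ_x`. -/
def diracComb (S : Set (EuclideanSpace ℝ (Fin d))) : Measure (EuclideanSpace ℝ (Fin d)) :=
  Measure.sum fun x : S => Measure.dirac (x : EuclideanSpace ℝ (Fin d))

/-- For a positive measure `ω` and a set `A`, the measure `(ω|_A * (ω|_A)~) / Vol A`, where
`μ~` is the image of the (positive, hence real) measure `μ` under `x ↦ -x`. -/
def finiteAutocorrelation (ω : Measure (EuclideanSpace ℝ (Fin d)))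
    (A : Set (EuclideanSpace ℝ (Fin d))) : Measure (EuclideanSpace ℝ (Fin d)) :=
  (volume A)⁻¹ • ((ω.restrict A) ∗ ((ω.restrict A).map fun x => -x))

/-- `γ` is an autocorrelation of the positive measure `ω` along `B`: a locally finite positive
measure that is a cluster point, in the vague topology (that is, the topology of pointwise
convergence on continuous functions with compact support), of the sequence of finite
autocorrelations of `ω` over `B n`. -/
structure IsAutocorrelation (B : ℕ → Set (EuclideanSpace ℝ (Fin d)))
    (ω γ : Measure (EuclideanSpace ℝ (Fin d))) : Prop where
  isFiniteMeasureOnCompacts : IsFiniteMeasureOnCompacts γ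
  mapClusterPt : MapClusterPt
    (fun f : C_c(EuclideanSpace ℝ (Fin d), ℝ) => ∫ x, f x ∂γ) atTop
    (fun n (f : C_c(EuclideanSpace ℝ (Fin d), ℝ)) => ∫ x, f x ∂(finiteAutocorrelation ω (B n)))

/-- The positive measure `ν` is the Fourier transform of the positive measure `γ` (both being
tempered), with the normalization `∫ φ dν = ∫ (𝓕 φ) dγ` for all Schwartz functions `φ`. If `γ` is
an autocorrelation, `ν` is the corresponding diffraction measure. -/
def IsFourierTransform (γ ν : Measure (EuclideanSpace ℝ (Fin d))) : Prop :=
  ∃ (_ : γ.HasTemperateGrowth) (_ : ν.HasTemperateGrowth),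
    𝓕 γ.toTemperedDistribution = ν.toTemperedDistribution

/-- The set of Bragg peaks (Bragg spectrum) of a diffraction measure `ν`: its atoms. -/
def braggSpectrum (ν : Measure (EuclideanSpace ℝ (Fin d))) :
    Set (EuclideanSpace ℝ (Fin d)) :=
  {χ | ν {χ} ≠ 0}

end MeyerDiffraction

end

noncomputable section

namespace MeyerDiffraction

variable {d : ℕ}

/-! ### Counting points of separated sets -/

/-! Write `a`, `b` for the lower and upper densities of `Λ` and `ρ` for the upper density of the
symmetric difference. The hypothesis says exactly `b + ρ < √2 (a - ρ)`. Since `Λ ∩ Γ` has lower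
density at least `a - ρ` and `Γ` has upper density at most `b + ρ`, there are `α`, `β` with `β² <
2α²` bounding these two densities from below and above, uniformly over translates
(`exists_density_bounds`).

Let `χ` be `η`-trivial on `Λ - Λ`, and weight the pairs of points of `Γ ∩ B n` by an `L¹`-normalized
nonnegative kernel `dilate h R` of their difference. Pairs inside `Λ` have `Re χ(x - y) ≥ 1 - η`,
all others have at least `-1`. The twisted double sum is therefore at least `(2 - η)` times the
untwisted sum over `Λ ∩ Γ` minus the untwisted sum over `Γ`. Per unit volume, up to small errors,
the first sum is at least `α²` and the second at most `β²`, so a positive bound remains, uniform in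
`χ` and in large `R` (`exists_le_integral_dilate_mul_re_character`). The bound survives the vague
limit, because for fixed `R` the kernel has compact support.

On the Fourier side, the twisted mean of `γ` is the `ν`-integral of a Schwartz function contracted
around `χ`. If `ν {χ} = 0`, it tends to `0` as `R → ∞` by dominated convergence
(`IsFourierTransform.tendsto_integral_dilate_mul_character`), contradicting the lower bound.

For the existence of `ν`, the transform of a finite autocorrelation is the positive density `V⁻¹ |∑
e^{-2πi x·k}|²`. These densities have uniformly bounded mass on unit balls, hence a vague limit that
is tempered, and the Fourier duality passes to the limit (`exists_isFourierTransform`). -/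

lemma pairwiseDisjoint_ball_half {r : ℝ≥0} {S : Set (EuclideanSpace ℝ (Fin d))}
    (hS : IsSeparated r S) : S.PairwiseDisjoint fun x => ball x (r / 2 : ℝ) := by
  intro x hx y hy hxy
  apply ball_disjoint_ball
  have h : (r : ℝ≥0∞) < edist x y := hS hx hy hxy
  rw [edist_nndist, ENNReal.coe_lt_coe] at h
  have h' : (r : ℝ) < dist x y := by exact_mod_cast h
  linarith

lemma sum_setLIntegral_ball_le {r : ℝ≥0} {F : Finset (EuclideanSpace ℝ (Fin d))}
    (hF : IsSeparated r (F : Set (EuclideanSpace ℝ (Fin d))))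
    (g : EuclideanSpace ℝ (Fin d) → ℝ≥0∞) {A : Set (EuclideanSpace ℝ (Fin d))}
    (hA : ∀ x ∈ F, ball x (r / 2 : ℝ) ⊆ A) :
    ∑ x ∈ F, ∫⁻ y in ball x (r / 2 : ℝ), g y ≤ ∫⁻ y in A, g y := by
  rw [← lintegral_biUnion_finset (pairwiseDisjoint_ball_half hF)
    (fun _ _ => measurableSet_ball)]
  exact lintegral_mono_set (Set.iUnion₂_subset hA)

lemma card_mul_volume_ball_le {r : ℝ≥0} {F : Finset (EuclideanSpace ℝ (Fin d))}
    (hF : IsSeparated r (F : Set (EuclideanSpace ℝ (Fin d))))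
    {A : Set (EuclideanSpace ℝ (Fin d))} (hA : ∀ x ∈ F, ball x (r / 2 : ℝ) ⊆ A) :
    F.card * volume (ball (0 : EuclideanSpace ℝ (Fin d)) (r / 2 : ℝ)) ≤ volume A := by
  have h := sum_setLIntegral_ball_le hF (fun _ => 1) hA
  simpa [Measure.addHaar_ball_center] using h

lemma encard_mul_volume_ball_le {r : ℝ≥0} {S : Set (EuclideanSpace ℝ (Fin d))}
    (hS : IsSeparated r S) (hfin : S.Finite)
    {A : Set (EuclideanSpace ℝ (Fin d))} (hA : ∀ x ∈ S, ball x (r / 2 : ℝ) ⊆ A) :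
    (S.encard : ℝ≥0∞) * volume (ball (0 : EuclideanSpace ℝ (Fin d)) (r / 2 : ℝ)) ≤ volume A := by
  have h := card_mul_volume_ball_le (F := hfin.toFinset) (by simpa using hS) (A := A)
    (by simpa using hA)
  rw [hfin.encard_eq_coe_toFinset_card]
  simpa using h

lemma volume_ball_half_pos {r : ℝ≥0} (hr : 0 < r) :
    0 < volume (ball (0 : EuclideanSpace ℝ (Fin d)) (r / 2 : ℝ)) :=
  measure_ball_pos _ _ (by have : (0 : ℝ) < r := hr
                           linarith)

lemma finite_of_isSeparated {r : ℝ≥0} (hr : 0 < r) {S : Set (EuclideanSpace ℝ (Fin d))}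
    (hS : IsSeparated r S) (hb : Bornology.IsBounded S) : S.Finite := by
  by_contra hinf
  have hb' : Bornology.IsBounded (thickening (r / 2 : ℝ) S) := hb.thickening
  have hlt : volume (thickening (r / 2 : ℝ) S) < ⊤ := hb'.measure_lt_top
  have hpos := volume_ball_half_pos (d := d) hr
  obtain ⟨n, hn⟩ := ENNReal.exists_nat_mul_gt hpos.ne' hlt.ne
  obtain ⟨F, hFS, hFn⟩ := Set.Infinite.exists_subset_card_eq hinf n
  have h := card_mul_volume_ball_le (hS.mono hFS) (A := thickening (r / 2 : ℝ) S)
    (fun x hx => ball_subset_thickening (hFS hx) _)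
  rw [hFn] at h
  exact absurd hn (not_lt.mpr h)

lemma isSeparated_of_sub {r : ℝ≥0} {S : Set (EuclideanSpace ℝ (Fin d))}
    (hS : IsSeparated r (S - S)) : IsSeparated r S := by
  intro x hx y hy hxy
  have h : (r : ℝ≥0∞) < edist (x - x) (y - x) :=
    hS (Set.sub_mem_sub hx hx) (Set.sub_mem_sub hy hx) fun h => hxy (sub_left_injective h)
  rwa [edist_sub_right] at h

/-- The polynomially decaying weight `x ↦ (1 + ‖x‖) ^ (-N)`. -/
def weight (N : ℕ) (x : EuclideanSpace ℝ (Fin d)) : ℝ := ((1 + ‖x‖) ^ N)⁻¹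

lemma weight_pos (N : ℕ) (x : EuclideanSpace ℝ (Fin d)) : 0 < weight N x := by
  unfold weight
  positivity

lemma continuous_weight (N : ℕ) :
    Continuous (weight N : EuclideanSpace ℝ (Fin d) → ℝ) := by
  unfold weight
  refine Continuous.inv₀ (by fun_prop) fun x => ?_
  positivity

lemma integrable_weight {N : ℕ} (hN : d < N) :
    Integrable (weight N : EuclideanSpace ℝ (Fin d) → ℝ) := by
  have h := integrable_one_add_norm (E := EuclideanSpace ℝ (Fin d)) (μ := volume) (r := N)
    (by simpa using hN)
  refine h.congr (ae_of_all _ fun x => ?_)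
  simp [weight, Real.rpow_neg (show 0 ≤ 1 + ‖x‖ by positivity)]

/-- Sums of an integrable radial weight over separated sets are uniformly bounded. -/
lemma exists_sum_weight_le {r : ℝ≥0} (hr : 0 < r) {N : ℕ} (hN : d < N) :
    ∃ C : ℝ, 0 ≤ C ∧ ∀ F : Finset (EuclideanSpace ℝ (Fin d)),
      IsSeparated r (F : Set (EuclideanSpace ℝ (Fin d))) →
      ∀ x, ∑ y ∈ F, weight N (x - y) ≤ C := by
  have hint := integrable_weight hN
  set V : ℝ := volume.real (ball (0 : EuclideanSpace ℝ (Fin d)) (r / 2 : ℝ)) with hV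
  have hVpos : 0 < V := ENNReal.toReal_pos (volume_ball_half_pos hr).ne' measure_ball_lt_top.ne
  have hw0 : 0 ≤ ∫ z, weight N z := integral_nonneg fun z : EuclideanSpace ℝ (Fin d) =>
    (weight_pos N z).le
  -- The weight changes by a factor at most `(1 + r) ^ N` over a ball of radius `r / 2`, so each
  -- term is bounded by its average over such a ball; the balls are disjoint.
  refine ⟨(1 + r) ^ N * (∫ z : EuclideanSpace ℝ (Fin d), weight N z) / V, by positivity, fun F hF x => ?_⟩
  rw [le_div_iff₀ hVpos, Finset.sum_mul]
  have hint' : Integrable fun z => (1 + r : ℝ) ^ N * weight N (x - z) := (hint.comp_sub_left x).const_mul _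
  calc ∑ y ∈ F, weight N (x - y) * V
      ≤ ∑ y ∈ F, ∫ z in ball y (r / 2 : ℝ), (1 + r : ℝ) ^ N * weight N (x - z) := by
        refine Finset.sum_le_sum fun y _ => ?_
        have hc : weight N (x - y) * V = ∫ z in ball y (r / 2 : ℝ), weight N (x - y) := by
          simp [hV, Measure.real, Measure.addHaar_ball_center, mul_comm]
        rw [hc]
        refine setIntegral_mono_on (integrableOn_const measure_ball_lt_top.ne) hint'.integrableOn
          measurableSet_ball fun z hz => ?_
        have hzy : ‖z - y‖ ≤ r := by
          rw [mem_ball, dist_eq_norm] at hz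
          have : (0 : ℝ) ≤ r := r.2
          linarith
        have h1 : 1 + ‖x - z‖ ≤ (1 + r) * (1 + ‖x - y‖) := by
          have h2 : ‖x - z‖ ≤ ‖x - y‖ + ‖z - y‖ := by
            rw [show x - z = (x - y) - (z - y) by abel]
            exact norm_sub_le _ _
          have : (0 : ℝ) ≤ r * ‖x - y‖ := by positivity
          linarith
        rw [weight, weight, ← div_eq_mul_inv, le_div_iff₀ (by positivity), inv_mul_le_iff₀ (by positivity),
          mul_comm, ← mul_pow]
        gcongr
    _ = ∫ z in ⋃ y ∈ F, ball y (r / 2 : ℝ), (1 + r : ℝ) ^ N * weight N (x - z) := by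
        rw [integral_biUnion_finset F (fun _ _ => measurableSet_ball)
          (pairwiseDisjoint_ball_half hF) (fun _ _ => hint'.integrableOn)]
    _ ≤ ∫ z, (1 + r : ℝ) ^ N * weight N (x - z) :=
        setIntegral_le_integral hint' (ae_of_all _ fun z => mul_nonneg (by positivity) (weight_pos N _).le)
    _ = (1 + r) ^ N * ∫ z : EuclideanSpace ℝ (Fin d), weight N z := by
        rw [integral_const_mul, integral_sub_left_eq_self (weight N) volume x]

/-! ### Van Hove sequences -/

lemma IsVanHove.volume_ne_top {B : ℕ → Set (EuclideanSpace ℝ (Fin d))} (hB : IsVanHove B) (n : ℕ) :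
    volume (B n) ≠ ⊤ :=
  (hB.isBounded n).measure_lt_top.ne

lemma IsVanHove.volume_real_pos {B : ℕ → Set (EuclideanSpace ℝ (Fin d))} (hB : IsVanHove B)
    (n : ℕ) : 0 < volume.real (B n) :=
  ENNReal.toReal_pos (hB.volume_pos n).ne' (hB.volume_ne_top n)

lemma thickening_subset_union_vanHoveBoundary (A : Set (EuclideanSpace ℝ (Fin d))) (s : ℝ) :
    thickening s A ⊆ A ∪ vanHoveBoundary (closedBall 0 s) A := by
  intro x hx
  by_cases hxA : x ∈ A
  · exact Or.inl hxA
  obtain ⟨y, hy, hxy⟩ := mem_thickening_iff.mp hx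
  refine Or.inr (Or.inl ⟨⟨y, hy, x - y, ?_, by simp⟩, fun h => hxA (interior_subset h)⟩)
  simpa [dist_eq_norm] using hxy.le

/-- A packing bound: the disjoint balls of radius `r / 2` around the counted points lie in a
thickening of the window, whose volume is at most `2 * volume (B n)` once the boundary is no larger
than the window. Neither `C` nor the threshold on `n` depends on `S` or `x`. -/
lemma IsVanHove.eventually_relFrequency_le {B : ℕ → Set (EuclideanSpace ℝ (Fin d))}
    (hB : IsVanHove B) {r : ℝ≥0} (hr : 0 < r) : ∃ C : ℝ≥0∞, C ≠ ⊤ ∧ ∀ᶠ n in atTop,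
      ∀ S : Set (EuclideanSpace ℝ (Fin d)), IsSeparated r S → ∀ x, relFrequency S (B n) x ≤ C := by
  set v := volume (ball (0 : EuclideanSpace ℝ (Fin d)) (r / 2 : ℝ)) with hv
  have hvpos : 0 < v := volume_ball_half_pos hr
  refine ⟨2 / v, ENNReal.div_ne_top (by simp) hvpos.ne', ?_⟩
  have h := (hB.tendsto_boundary (closedBall 0 (r / 2 : ℝ))
    (isCompact_closedBall _ _)).eventually_lt_const (u := 1) (by simp)
  filter_upwards [h] with n hn S hS x
  have hb : volume (vanHoveBoundary (closedBall 0 (r / 2 : ℝ)) (B n)) ≤ volume (B n) := by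
    have h1 := hn.le
    rwa [ENNReal.div_le_iff (hB.volume_pos n).ne' (hB.volume_ne_top n), one_mul] at h1
  have hsep : IsSeparated r (S ∩ (x +ᵥ B n)) := hS.mono Set.inter_subset_left
  have hfin : (S ∩ (x +ᵥ B n)).Finite :=
    finite_of_isSeparated hr hsep (((hB.isBounded n).vadd x).subset Set.inter_subset_right)
  have h2 := encard_mul_volume_ball_le hsep hfin (A := x +ᵥ thickening (r / 2 : ℝ) (B n)) (by
    rintro y ⟨-, z, hz, rfl⟩ w hw
    refine ⟨w - x, ?_, by simp⟩
    refine mem_thickening_iff.mpr ⟨z, hz, ?_⟩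
    rw [mem_ball] at hw
    simpa [dist_eq_norm, sub_sub] using hw)
  rw [measure_vadd] at h2
  have h3 : volume (thickening (r / 2 : ℝ) (B n)) ≤ 2 * volume (B n) := by
    refine (measure_mono (thickening_subset_union_vanHoveBoundary _ _)).trans
      ((measure_union_le _ _).trans ?_)
    rw [two_mul]
    gcongr
  rw [relFrequency, ENNReal.div_le_iff (hB.volume_pos n).ne' (hB.volume_ne_top n),
    mul_comm, ← mul_div_assoc, ENNReal.le_div_iff_mul_le (Or.inl hvpos.ne')
    (Or.inl measure_ball_lt_top.ne), mul_comm (volume (B n))]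
  exact h2.trans h3

lemma upperDensity_ne_top_of_eventually_le {B : ℕ → Set (EuclideanSpace ℝ (Fin d))}
    {S : Set (EuclideanSpace ℝ (Fin d))} {C : ℝ≥0∞} (hC : C ≠ ⊤)
    (h : ∀ᶠ n in atTop, ∀ x, relFrequency S (B n) x ≤ C) : upperDensity B S ≠ ⊤ := by
  refine ne_top_of_le_ne_top hC ?_
  refine limsup_le_of_le (by isBoundedDefault) ?_
  filter_upwards [h] with n hn using iSup_le hn

lemma lowerDensity_le_upperDensity (B : ℕ → Set (EuclideanSpace ℝ (Fin d)))
    (S : Set (EuclideanSpace ℝ (Fin d))) : lowerDensity B S ≤ upperDensity B S :=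
  (liminf_le_liminf (Eventually.of_forall fun _ => iInf_le_iSup)).trans (liminf_le_limsup)

lemma relFrequency_eq_ofReal {S A : Set (EuclideanSpace ℝ (Fin d))} (hA : 0 < volume A)
    (hA' : volume A ≠ ⊤) {x : EuclideanSpace ℝ (Fin d)} (hfin : (S ∩ (x +ᵥ A)).Finite) :
    relFrequency S A x = ENNReal.ofReal ((S ∩ (x +ᵥ A)).ncard / volume.real A) := by
  rw [measureReal_def, ENNReal.ofReal_div_of_pos (ENNReal.toReal_pos hA.ne' hA'),
    ENNReal.ofReal_toReal hA', relFrequency, ← hfin.cast_ncard_eq]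
  simp

lemma eventually_ncard_le_of_upperDensity_lt {B : ℕ → Set (EuclideanSpace ℝ (Fin d))}
    (hB : IsVanHove B) {S : Set (EuclideanSpace ℝ (Fin d))}
    (hfin : ∀ A, Bornology.IsBounded A → (S ∩ A).Finite) {b : ℝ} (hS : upperDensity B S ≠ ⊤)
    (h : (upperDensity B S).toReal < b) :
    ∀ᶠ n in atTop, ∀ x : EuclideanSpace ℝ (Fin d), ((S ∩ (x +ᵥ B n)).ncard : ℝ) ≤ b * volume.real (B n) := by
  have h' : upperDensity B S < ENNReal.ofReal b := (ENNReal.lt_ofReal_iff_toReal_lt hS).mpr h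
  filter_upwards [eventually_lt_of_limsup_lt h'] with n hn x
  have h1 := (le_iSup _ x).trans hn.le
  rw [relFrequency_eq_ofReal (hB.volume_pos n) (hB.volume_ne_top n)
    (hfin _ ((hB.isBounded n).vadd x)), ENNReal.ofReal_le_ofReal_iff
    (ENNReal.toReal_nonneg.trans h.le), div_le_iff₀ (hB.volume_real_pos n)] at h1
  exact h1

lemma eventually_le_ncard_of_lt_lowerDensity {B : ℕ → Set (EuclideanSpace ℝ (Fin d))}
    (hB : IsVanHove B) {S : Set (EuclideanSpace ℝ (Fin d))}
    (hfin : ∀ A, Bornology.IsBounded A → (S ∩ A).Finite) {a : ℝ} (hS : lowerDensity B S ≠ ⊤)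
    (h : a < (lowerDensity B S).toReal) :
    ∀ᶠ n in atTop, ∀ x : EuclideanSpace ℝ (Fin d), a * volume.real (B n) ≤ ((S ∩ (x +ᵥ B n)).ncard : ℝ) := by
  -- For negative `a`, passing to `ENNReal.ofReal a` would truncate, but the bound is then trivial.
  rcases lt_or_ge a 0 with ha | ha
  · exact Eventually.of_forall fun n x => (mul_nonpos_of_nonpos_of_nonneg ha.le
      measureReal_nonneg).trans (by positivity)
  have h' : ENNReal.ofReal a < lowerDensity B S := (ENNReal.ofReal_lt_iff_lt_toReal ha hS).mpr h
  filter_upwards [eventually_lt_of_lt_liminf h'] with n hn x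
  have h1 := hn.le.trans (iInf_le _ x)
  rw [relFrequency_eq_ofReal (hB.volume_pos n) (hB.volume_ne_top n)
    (hfin _ ((hB.isBounded n).vadd x)), ENNReal.ofReal_le_ofReal_iff
    (by positivity), le_div_iff₀ (hB.volume_real_pos n)] at h1
  exact h1

/-- If `Γ` differs from `Λ` by a set of small upper density, then `Λ ∩ Γ` carries more than
the proportion `1 / √2` of the points of `Γ`. -/
lemma exists_density_bounds {B : ℕ → Set (EuclideanSpace ℝ (Fin d))} (hB : IsVanHove B)
    {Λ Γ : Set (EuclideanSpace ℝ (Fin d))} {r s : ℝ≥0} (hr : 0 < r) (hΛ : IsSeparated r Λ)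
    (hs : 0 < s) (hΓ : IsSeparated s Γ)
    (hdens : (upperDensity B (symmDiff Λ Γ)).toReal <
      (√2 * (lowerDensity B Λ).toReal - (upperDensity B Λ).toReal) / (√2 + 1)) :
    ∃ α β : ℝ, 0 < α ∧ 0 < β ∧ β ^ 2 < 2 * α ^ 2 ∧ ∀ᶠ n in atTop,
      ∀ x : EuclideanSpace ℝ (Fin d),
      α * volume.real (B n) ≤ ((Λ ∩ Γ ∩ (x +ᵥ B n)).ncard : ℝ) ∧
      ((Γ ∩ (x +ᵥ B n)).ncard : ℝ) ≤ β * volume.real (B n) := by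
  have hfinΛ : ∀ A, Bornology.IsBounded A → (Λ ∩ A).Finite := fun A hA =>
    finite_of_isSeparated hr (hΛ.mono Set.inter_subset_left) (hA.subset Set.inter_subset_right)
  have hfinΓ : ∀ A, Bornology.IsBounded A → (Γ ∩ A).Finite := fun A hA =>
    finite_of_isSeparated hs (hΓ.mono Set.inter_subset_left) (hA.subset Set.inter_subset_right)
  have hfinD : ∀ A, Bornology.IsBounded A → (symmDiff Λ Γ ∩ A).Finite := fun A hA =>
    ((hfinΛ A hA).union (hfinΓ A hA)).subset (by
      rw [← Set.union_inter_distrib_right]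
      exact Set.inter_subset_inter_left _ Set.symmDiff_subset_union)
  -- Packing makes all three densities finite, so that `toReal` never returns its default value `0`.
  obtain ⟨C, hC, hCn⟩ := hB.eventually_relFrequency_le hr
  obtain ⟨C', hC', hCn'⟩ := hB.eventually_relFrequency_le hs
  have htopΛ : upperDensity B Λ ≠ ⊤ :=
    upperDensity_ne_top_of_eventually_le hC (hCn.mono fun n hn => hn Λ hΛ)
  have htopD : upperDensity B (symmDiff Λ Γ) ≠ ⊤ := by
    refine upperDensity_ne_top_of_eventually_le (C := C + C') (by simp [hC, hC']) ?_
    filter_upwards [hCn, hCn'] with n hn hn' x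
    have h1 := add_le_add (hn Λ hΛ x) (hn' Γ hΓ x)
    refine le_trans ?_ h1
    rw [relFrequency, relFrequency, relFrequency, ← ENNReal.add_div]
    gcongr
    have h2 : (symmDiff Λ Γ ∩ (x +ᵥ B n)).encard
        ≤ (Λ ∩ (x +ᵥ B n)).encard + (Γ ∩ (x +ᵥ B n)).encard := by
      refine le_trans (Set.encard_le_encard ?_) (Set.encard_union_le _ _)
      rw [← Set.union_inter_distrib_right]
      exact Set.inter_subset_inter_left _ Set.symmDiff_subset_union
    exact_mod_cast h2
  have htopL : lowerDensity B Λ ≠ ⊤ := ne_top_of_le_ne_top htopΛ (lowerDensity_le_upperDensity B Λ)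
  set a := (lowerDensity B Λ).toReal
  set b := (upperDensity B Λ).toReal
  set ρ := (upperDensity B (symmDiff Λ Γ)).toReal
  have hb0 : 0 ≤ b := ENNReal.toReal_nonneg
  have hρ0 : 0 ≤ ρ := ENNReal.toReal_nonneg
  have h2 : (0 : ℝ) < √2 := by positivity
  have hsq : √2 ^ 2 = 2 := Real.sq_sqrt (by norm_num)
  have hgap : ρ * (√2 + 1) < √2 * a - b := (lt_div_iff₀ (by positivity)).mp hdens
  -- Each count below uses two density estimates, each costing `δ`. The total loss `2 * (√2 + 1) *
  -- δ` is half of the gap in `hgap`.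
  set δ := (√2 * a - b - ρ * (√2 + 1)) / (4 * (√2 + 1)) with hδ
  have hδ0 : 0 < δ := div_pos (by linarith) (by positivity)
  have hδ' : 4 * (√2 + 1) * δ = √2 * a - b - ρ * (√2 + 1) := by
    rw [hδ]; field_simp
  have hkey : b + ρ + 2 * δ < √2 * (a - ρ - 2 * δ) := by
    nlinarith [mul_pos h2 hδ0]
  refine ⟨a - ρ - 2 * δ, b + ρ + 2 * δ, ?_, by positivity, ?_, ?_⟩
  · exact pos_of_mul_pos_right (lt_trans (by positivity) hkey) h2.le
  · calc (b + ρ + 2 * δ) ^ 2 < (√2 * (a - ρ - 2 * δ)) ^ 2 :=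
        pow_lt_pow_left₀ hkey (by positivity) two_ne_zero
      _ = 2 * (a - ρ - 2 * δ) ^ 2 := by rw [mul_pow, hsq]
  filter_upwards [eventually_ncard_le_of_upperDensity_lt hB hfinΛ htopΛ
      (show b < b + δ by linarith),
    eventually_ncard_le_of_upperDensity_lt hB hfinD htopD (show ρ < ρ + δ by linarith),
    eventually_le_ncard_of_lt_lowerDensity hB hfinΛ htopL (show a - δ < a by linarith)]
    with n h1 h2 h3 x
  have hbd := (hB.isBounded n).vadd x
  set A := x +ᵥ B n
  have h4 : (Λ ∩ A).ncard ≤ (Λ ∩ Γ ∩ A).ncard + (symmDiff Λ Γ ∩ A).ncard := by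
    refine (Set.ncard_le_ncard ?_ (((hfinΛ A hbd).subset ?_).union (hfinD A hbd))).trans
      (Set.ncard_union_le _ _)
    · rintro y ⟨hy, hyA⟩
      by_cases hyΓ : y ∈ Γ
      · exact Or.inl ⟨⟨hy, hyΓ⟩, hyA⟩
      · exact Or.inr ⟨Or.inl ⟨hy, hyΓ⟩, hyA⟩
    · exact Set.inter_subset_inter_left _ Set.inter_subset_left
  have h5 : (Γ ∩ A).ncard ≤ (Λ ∩ A).ncard + (symmDiff Λ Γ ∩ A).ncard := by
    refine (Set.ncard_le_ncard ?_ ((hfinΛ A hbd).union (hfinD A hbd))).trans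
      (Set.ncard_union_le _ _)
    rintro y ⟨hy, hyA⟩
    by_cases hyΛ : y ∈ Λ
    · exact Or.inl ⟨hyΛ, hyA⟩
    · exact Or.inr ⟨Or.inr ⟨hy, hyΛ⟩, hyA⟩
  have h4' : ((Λ ∩ A).ncard : ℝ) ≤ (Λ ∩ Γ ∩ A).ncard + (symmDiff Λ Γ ∩ A).ncard := by
    exact_mod_cast h4
  have h5' : ((Γ ∩ A).ncard : ℝ) ≤ (Λ ∩ A).ncard + (symmDiff Λ Γ ∩ A).ncard := by
    exact_mod_cast h5
  have h1x := h1 x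
  have h2x := h2 x
  have h3x := h3 x
  constructor <;> linarith

/-! ### Finite autocorrelations as double sums -/

lemma restrict_diracComb {S A : Set (EuclideanSpace ℝ (Fin d))} (hA : MeasurableSet A)
    {F : Finset (EuclideanSpace ℝ (Fin d))} (hF : (F : Set (EuclideanSpace ℝ (Fin d))) = S ∩ A) :
    (diracComb S).restrict A = ∑ x ∈ F, Measure.dirac x := by
  ext s hs
  rw [Measure.restrict_apply hs, diracComb, Measure.sum_apply _ (hs.inter hA),
    Measure.finsetSum_apply]
  simp only [Measure.dirac_apply' _ (hs.inter hA), Measure.dirac_apply' _ hs]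
  rw [tsum_subtype S fun x => (s ∩ A).indicator 1 x, tsum_eq_sum (s := F)]
  · refine Finset.sum_congr rfl fun x hx => ?_
    have hx' : x ∈ S ∩ A := hF ▸ Finset.mem_coe.mpr hx
    by_cases hxs : x ∈ s <;> simp [hxs, hx'.1, hx'.2]
  · intro x hx
    have hx' : x ∉ S ∩ A := fun h => hx (Finset.mem_coe.mp (hF ▸ h))
    by_cases hxS : x ∈ S
    · have : x ∉ A := fun h => hx' ⟨hxS, h⟩
      simp [Set.indicator, this]
    · simp [hxS]

lemma finiteAutocorrelation_diracComb {S A : Set (EuclideanSpace ℝ (Fin d))}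
    (hA : MeasurableSet A) {F : Finset (EuclideanSpace ℝ (Fin d))}
    (hF : (F : Set (EuclideanSpace ℝ (Fin d))) = S ∩ A) :
    finiteAutocorrelation (diracComb S) A
      = (volume A)⁻¹ • ∑ x ∈ F, ∑ y ∈ F, Measure.dirac (x - y) := by
  rw [finiteAutocorrelation, restrict_diracComb hA hF]
  congr 1
  ext s hs
  rw [← lintegral_indicator_one hs, Measure.lintegral_conv (measurable_one.indicator hs),
    lintegral_finsetSum_measure, Measure.finsetSum_apply]
  refine Finset.sum_congr rfl fun x _ => ?_
  rw [lintegral_dirac, lintegral_map (f := fun y => s.indicator 1 (x + y))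
    ((measurable_one.indicator hs).comp (measurable_const_add x)) measurable_neg, lintegral_finsetSum_measure, Measure.finsetSum_apply]
  refine Finset.sum_congr rfl fun y _ => ?_
  rw [lintegral_dirac, Measure.dirac_apply' _ hs, sub_eq_add_neg]

lemma integral_finiteAutocorrelation_diracComb {S A : Set (EuclideanSpace ℝ (Fin d))}
    (hA : MeasurableSet A) {F : Finset (EuclideanSpace ℝ (Fin d))}
    (hF : (F : Set (EuclideanSpace ℝ (Fin d))) = S ∩ A) {G : Type*} [NormedAddCommGroup G]
    [NormedSpace ℝ G] [CompleteSpace G] (f : EuclideanSpace ℝ (Fin d) → G) :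
    ∫ z, f z ∂(finiteAutocorrelation (diracComb S) A)
      = (volume.real A)⁻¹ • ∑ x ∈ F, ∑ y ∈ F, f (x - y) := by
  have hi : ∀ z, Integrable f (Measure.dirac z) := fun z => integrable_dirac (by simp)
  rw [finiteAutocorrelation_diracComb hA hF, integral_smul_measure, ENNReal.toReal_inv,
    integral_finsetSum_measure fun x _ => integrable_finsetSum_measure.mpr fun y _ => hi _]
  simp_rw [integral_finsetSum_measure fun y _ => hi _, integral_dirac]
  rfl

lemma lintegral_finiteAutocorrelation_diracComb {S A : Set (EuclideanSpace ℝ (Fin d))}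
    (hA : MeasurableSet A) {F : Finset (EuclideanSpace ℝ (Fin d))}
    (hF : (F : Set (EuclideanSpace ℝ (Fin d))) = S ∩ A) (f : EuclideanSpace ℝ (Fin d) → ℝ≥0∞) :
    ∫⁻ z, f z ∂(finiteAutocorrelation (diracComb S) A)
      = (volume A)⁻¹ * ∑ x ∈ F, ∑ y ∈ F, f (x - y) := by
  rw [finiteAutocorrelation_diracComb hA hF, lintegral_smul_measure, lintegral_finsetSum_measure]
  simp_rw [lintegral_finsetSum_measure, lintegral_dirac]
  rfl

/-! ### Averaging against slowly varying functions -/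

/-- The `L¹`-normalized dilation `x ↦ R ^ (-d) * h (x / R)` on `ℝ^d`. -/
def dilate (h : EuclideanSpace ℝ (Fin d) → ℝ) (R : ℝ) (x : EuclideanSpace ℝ (Fin d)) : ℝ :=
  (R ^ d)⁻¹ * h (R⁻¹ • x)

lemma dilate_nonneg {h : EuclideanSpace ℝ (Fin d) → ℝ} (hh : ∀ x, 0 ≤ h x) {R : ℝ} (hR : 0 ≤ R)
    (x : EuclideanSpace ℝ (Fin d)) : 0 ≤ dilate h R x :=
  mul_nonneg (by positivity) (hh _)

lemma dilate_eq_zero {h : EuclideanSpace ℝ (Fin d) → ℝ} (hh : ∀ x, 1 ≤ ‖x‖ → h x = 0) {R : ℝ}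
    (hR : 0 < R) {x : EuclideanSpace ℝ (Fin d)} (hx : R ≤ ‖x‖) : dilate h R x = 0 := by
  rw [dilate, hh, mul_zero]
  rw [norm_smul, norm_inv, Real.norm_of_nonneg hR.le, ← div_eq_inv_mul, le_div_iff₀ hR]
  linarith

lemma integral_dilate (h : EuclideanSpace ℝ (Fin d) → ℝ) {R : ℝ} (hR : 0 < R) :
    ∫ x, dilate h R x = ∫ x, h x := by
  simp_rw [dilate, integral_const_mul]
  rw [Measure.integral_comp_inv_smul_of_nonneg volume h hR.le]
  simp only [finrank_euclideanSpace, Fintype.card_fin, smul_eq_mul]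
  rw [← mul_assoc, inv_mul_cancel₀ (by positivity), one_mul]

lemma continuous_dilate {h : EuclideanSpace ℝ (Fin d) → ℝ} (hh : Continuous h) (R : ℝ) :
    Continuous (dilate h R) := by
  unfold dilate
  fun_prop

lemma hasCompactSupport_dilate {h : EuclideanSpace ℝ (Fin d) → ℝ}
    (hh : ∀ x, 1 ≤ ‖x‖ → h x = 0) {R : ℝ} (hR : 0 < R) : HasCompactSupport (dilate h R) := by
  refine HasCompactSupport.intro (isCompact_closedBall 0 R) fun x hx => ?_
  refine dilate_eq_zero hh hR ?_
  simp only [mem_closedBall, dist_zero_right, not_le] at hx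
  exact hx.le

lemma abs_dilate_sub_le {h : EuclideanSpace ℝ (Fin d) → ℝ} {L : ℝ≥0} (hL : LipschitzWith L h)
    {R : ℝ} (hR : 0 < R) (x y : EuclideanSpace ℝ (Fin d)) :
    |dilate h R x - dilate h R y| ≤ (R ^ d)⁻¹ * (L * (R⁻¹ * ‖x - y‖)) := by
  have h1 := hL.dist_le_mul (R⁻¹ • x) (R⁻¹ • y)
  rw [Real.dist_eq, dist_eq_norm, ← smul_sub, norm_smul, norm_inv, Real.norm_of_nonneg hR.le] at h1
  rw [dilate, dilate, ← mul_sub, abs_mul, abs_of_nonneg (by positivity : 0 ≤ (R ^ d)⁻¹)]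
  gcongr

/-- The growth `R ^ d` is what the normalization `(R ^ d)⁻¹` of `dilate` cancels. -/
lemma card_le_of_subset_closedBall {r : ℝ≥0} (hr : 0 < r) {M : ℝ} (hM : 0 ≤ M) {R : ℝ}
    (hR : 1 ≤ R) {F : Finset (EuclideanSpace ℝ (Fin d))}
    (hF : IsSeparated r (F : Set (EuclideanSpace ℝ (Fin d)))) {x : EuclideanSpace ℝ (Fin d)}
    (hFx : ∀ y ∈ F, ‖x - y‖ ≤ R + M) :
    (F.card : ℝ) ≤ R ^ d * ((1 + M + r) ^ d *
      (volume.real (ball (0 : EuclideanSpace ℝ (Fin d)) 1) /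
        volume.real (ball (0 : EuclideanSpace ℝ (Fin d)) (r / 2 : ℝ)))) := by
  have hr0 : (0 : ℝ) < r := hr
  have h := card_mul_volume_ball_le hF (A := ball x (R * (1 + M + r))) fun y hy =>
    ball_subset_ball' (by
      have h1 := hFx y hy
      rw [dist_comm, dist_eq_norm]
      nlinarith)
  have h' := ENNReal.toReal_mono measure_ball_lt_top.ne h
  rw [Measure.addHaar_ball_of_pos volume x (by positivity), ENNReal.toReal_mul, ENNReal.toReal_mul,
    ENNReal.toReal_ofReal (by positivity), ENNReal.toReal_natCast] at h'
  simp only [finrank_euclideanSpace, Fintype.card_fin, mul_pow] at h'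
  rw [← mul_div_assoc, ← mul_div_assoc]
  simp only [measureReal_def]
  rw [le_div_iff₀
    (ENNReal.toReal_pos (volume_ball_half_pos hr).ne' measure_ball_lt_top.ne)]
  linarith

/-- Sum and integral are exchanged: `y` is counted in the window `t + A` exactly when `y - t ∈ A`.
-/
lemma integral_dilate_mul_ncard {h : EuclideanSpace ℝ (Fin d) → ℝ} (hc : Continuous h)
    {A : Set (EuclideanSpace ℝ (Fin d))} (hA : MeasurableSet A) (hA' : Bornology.IsBounded A)
    (R : ℝ) (F : Finset (EuclideanSpace ℝ (Fin d))) (x : EuclideanSpace ℝ (Fin d)) :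
    (Integrable fun t =>
      dilate h R (x - t) * (((F : Set (EuclideanSpace ℝ (Fin d))) ∩ (t +ᵥ A)).ncard : ℝ)) ∧
    ∫ t, dilate h R (x - t) * (((F : Set (EuclideanSpace ℝ (Fin d))) ∩ (t +ᵥ A)).ncard : ℝ)
      = ∑ y ∈ F, ∫ t in (fun t => y - t) ⁻¹' A, dilate h R (x - t) := by
  classical
  have hms : ∀ y : EuclideanSpace ℝ (Fin d), MeasurableSet ((fun t => y - t) ⁻¹' A) := fun y =>
    (measurable_const_sub y) hA
  have hb : ∀ y : EuclideanSpace ℝ (Fin d), Bornology.IsBounded ((fun t => y - t) ⁻¹' A) := by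
    intro y
    obtain ⟨M, hM⟩ := hA'.exists_norm_le
    refine (isBounded_iff_forall_norm_le).mpr ⟨‖y‖ + M, fun t ht => ?_⟩
    calc ‖t‖ = ‖y - (y - t)‖ := by rw [sub_sub_cancel]
      _ ≤ ‖y‖ + ‖y - t‖ := norm_sub_le _ _
      _ ≤ ‖y‖ + M := by gcongr; exact hM _ ht
  have hcount : ∀ t, dilate h R (x - t) *
      (((F : Set (EuclideanSpace ℝ (Fin d))) ∩ (t +ᵥ A)).ncard : ℝ)
      = ∑ y ∈ F, ((fun t => y - t) ⁻¹' A).indicator (fun t => dilate h R (x - t)) t := by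
    intro t
    have h1 : (F : Set (EuclideanSpace ℝ (Fin d))) ∩ (t +ᵥ A)
        = (F.filter fun y => y - t ∈ A : Finset (EuclideanSpace ℝ (Fin d))) := by
      ext y
      simp [Set.mem_vadd_set_iff_neg_vadd_mem, sub_eq_neg_add]
    rw [h1, Set.ncard_coe_finset, Finset.card_filter]
    push_cast
    rw [Finset.mul_sum]
    refine Finset.sum_congr rfl fun y _ => ?_
    simp [Set.indicator]
  have hcont : Continuous fun t => dilate h R (x - t) :=
    (continuous_dilate hc R).comp (continuous_sub_left x)
  have hint : ∀ y, IntegrableOn (fun t => dilate h R (x - t)) ((fun t => y - t) ⁻¹' A) :=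
    fun y => (hcont.continuousOn.integrableOn_compact (hb y).isCompact_closure).mono_set
      subset_closure
  simp_rw [hcount]
  refine ⟨integrable_finsetSum _ fun y _ => (hint y).integrable_indicator (hms y), ?_⟩
  rw [integral_finsetSum _ fun y _ => (hint y).integrable_indicator (hms y)]
  exact Finset.sum_congr rfl fun y _ => integral_indicator (hms y)

/-- A sum over a separated set of a dilated Lipschitz function is close to the integral of that
function against the local frequencies of the set. -/
lemma exists_abs_sum_dilate_sub_le {h : EuclideanSpace ℝ (Fin d) → ℝ} {L : ℝ≥0}
    (hL : LipschitzWith L h) {r : ℝ≥0} (hr : 0 < r) {A : Set (EuclideanSpace ℝ (Fin d))}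
    (hA : MeasurableSet A) (hApos : 0 < volume A) {M : ℝ} (hM : 0 ≤ M)
    (hAM : ∀ x ∈ A, ‖x‖ ≤ M) :
    ∃ C : ℝ, 0 ≤ C ∧ ∀ R, 1 ≤ R → ∀ F : Finset (EuclideanSpace ℝ (Fin d)),
      IsSeparated r (F : Set (EuclideanSpace ℝ (Fin d))) → ∀ x, (∀ y ∈ F, ‖x - y‖ ≤ R + M) →
      |∑ y ∈ F, dilate h R (x - y) - (volume.real A)⁻¹ *
        ∫ t, dilate h R (x - t) * (((F : Set (EuclideanSpace ℝ (Fin d))) ∩ (t +ᵥ A)).ncard : ℝ)|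
      ≤ C / R := by
  have hAb : Bornology.IsBounded A := isBounded_iff_forall_norm_le.mpr ⟨M, hAM⟩
  have hAtop : volume A ≠ ⊤ := hAb.measure_lt_top.ne
  have hV : 0 < volume.real A := ENNReal.toReal_pos hApos.ne' hAtop
  set K : ℝ := (1 + M + r) ^ d * (volume.real (ball (0 : EuclideanSpace ℝ (Fin d)) 1) /
    volume.real (ball (0 : EuclideanSpace ℝ (Fin d)) (r / 2 : ℝ))) with hK
  have hK0 : 0 ≤ K := by positivity
  refine ⟨K * (L * M), by positivity, fun R hR F hF x hFx => ?_⟩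
  have hR0 : 0 < R := by linarith
  rw [(integral_dilate_mul_ncard hL.continuous hA hAb R F x).2, Finset.mul_sum,
    ← Finset.sum_sub_distrib]
  -- The value at `y` is compared with the mean over `y - A`. All points involved are within `M`, so
  -- the Lipschitz bound gives an error of order `R ^ (-d - 1)`; there are `O(R ^ d)` terms, leaving
  -- `O(1 / R)`.
  have hterm : ∀ y ∈ F, |dilate h R (x - y) - (volume.real A)⁻¹ *
      ∫ t in (fun t => y - t) ⁻¹' A, dilate h R (x - t)| ≤ (R ^ d)⁻¹ * (L * (R⁻¹ * M)) := by
    intro y _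
    set T := (fun t : EuclideanSpace ℝ (Fin d) => y - t) ⁻¹' A with hT
    have hTV : volume T = volume A := by
      exact (Measure.measurePreserving_sub_left volume y).measure_preimage hA.nullMeasurableSet
    have hTr : volume.real T = volume.real A := by rw [measureReal_def, hTV, measureReal_def]
    have hcont : Continuous fun t => dilate h R (x - t) :=
      (continuous_dilate hL.continuous R).comp (continuous_sub_left x)
    have hTm : MeasurableSet T := (measurable_const_sub y) hA
    have hbound : ∀ t ∈ T, ‖dilate h R (x - y) - dilate h R (x - t)‖
        ≤ (R ^ d)⁻¹ * (L * (R⁻¹ * M)) := by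
      intro t ht
      refine (abs_dilate_sub_le hL hR0 _ _).trans ?_
      have : ‖x - y - (x - t)‖ ≤ M := by
        rw [sub_sub_sub_cancel_left, norm_sub_rev]
        exact hAM _ ht
      gcongr
    have hTb : Bornology.IsBounded T := by
      refine (isBounded_iff_forall_norm_le).mpr ⟨‖y‖ + M, fun t ht => ?_⟩
      calc ‖t‖ = ‖y - (y - t)‖ := by rw [sub_sub_cancel]
        _ ≤ ‖y‖ + ‖y - t‖ := norm_sub_le _ _
        _ ≤ ‖y‖ + M := by gcongr; exact hAM _ ht
    have hint : IntegrableOn (fun t => dilate h R (x - t)) T :=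
      (hcont.continuousOn.integrableOn_compact hTb.isCompact_closure).mono_set subset_closure
    have heq : dilate h R (x - y) - (volume.real A)⁻¹ * ∫ t in T, dilate h R (x - t)
        = (volume.real A)⁻¹ * ∫ t in T, (dilate h R (x - y) - dilate h R (x - t)) := by
      rw [integral_sub (integrableOn_const (C := dilate h R (x - y)) (by rw [hTV]; exact hAtop)) hint, setIntegral_const,
        hTr, smul_eq_mul, mul_sub, ← mul_assoc, inv_mul_cancel₀ hV.ne', one_mul]
    rw [heq, abs_mul, abs_of_pos (inv_pos.mpr hV), inv_mul_le_iff₀ hV, mul_comm, ← hTr]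
    exact norm_setIntegral_le_of_norm_le_const (by rw [hTV]; exact hAtop.lt_top) hbound
  calc _ ≤ ∑ y ∈ F, (R ^ d)⁻¹ * (L * (R⁻¹ * M)) :=
        (Finset.abs_sum_le_sum_abs _ _).trans (Finset.sum_le_sum hterm)
    _ = F.card * ((R ^ d)⁻¹ * (L * (R⁻¹ * M))) := by simp
    _ ≤ (R ^ d * K) * ((R ^ d)⁻¹ * (L * (R⁻¹ * M))) := by
        gcongr
        exact card_le_of_subset_closedBall hr hM hR hF hFx
    _ = K * (L * M) / R := by field_simp

/-- A count valid on all translates of a single window `A` controls kernel sums at every scale `R ≥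
1`: since the kernel is nonnegative of integral `1`, the kernel sum is, up to `C / R`, an average of
the local frequencies over `A`. -/
lemma sum_dilate_le {h : EuclideanSpace ℝ (Fin d) → ℝ} {L : ℝ≥0} (hL : LipschitzWith L h)
    (h0 : ∀ x, 0 ≤ h x) (hsupp : ∀ x, 1 ≤ ‖x‖ → h x = 0) (h1 : ∫ x, h x = 1)
    {r : ℝ≥0} (hr : 0 < r) {A : Set (EuclideanSpace ℝ (Fin d))}
    (hA : MeasurableSet A) (hApos : 0 < volume A) (hAb : Bornology.IsBounded A)
    {S : Set (EuclideanSpace ℝ (Fin d))} (hS : IsSeparated r S) {β : ℝ}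
    (hβ : ∀ t : EuclideanSpace ℝ (Fin d), ((S ∩ (t +ᵥ A)).ncard : ℝ) ≤ β * volume.real A) :
    ∃ C : ℝ, 0 ≤ C ∧ ∀ R, 1 ≤ R → ∀ F : Finset (EuclideanSpace ℝ (Fin d)),
      (F : Set (EuclideanSpace ℝ (Fin d))) ⊆ S → ∀ x,
        ∑ y ∈ F, dilate h R (x - y) ≤ β + C / R := by
  obtain ⟨M', hM'⟩ := hAb.exists_norm_le
  obtain ⟨C, hC0, hC⟩ := exists_abs_sum_dilate_sub_le hL hr hA hApos (le_max_right M' 0)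
    fun x hx => (hM' x hx).trans (le_max_left M' 0)
  refine ⟨C, hC0, fun R hR F hFS x => ?_⟩
  set M := max M' 0
  have hM0 : 0 ≤ M := le_max_right _ _
  have hR0 : 0 < R := by linarith
  have hV : 0 < volume.real A := ENNReal.toReal_pos hApos.ne' hAb.measure_lt_top.ne
  set F' := F.filter fun y => ‖x - y‖ ≤ R + M with hF'
  have hsum : ∑ y ∈ F, dilate h R (x - y) = ∑ y ∈ F', dilate h R (x - y) := by
    refine (Finset.sum_filter_of_ne fun y _ hy => ?_).symm
    by_contra hlt
    exact hy (dilate_eq_zero hsupp hR0 (by linarith))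
  have hF'S : (F' : Set (EuclideanSpace ℝ (Fin d))) ⊆ S := fun y hy =>
    hFS (Finset.mem_coe.mpr (Finset.mem_of_mem_filter y hy))
  have hb := (abs_le.mp (hC R hR F' (hS.mono hF'S) x fun y hy => (Finset.mem_filter.mp hy).2)).2
  have hint : Integrable fun t => dilate h R (x - t) :=
    ((continuous_dilate hL.continuous R).integrable_of_hasCompactSupport
      (hasCompactSupport_dilate hsupp hR0)).comp_sub_left x
  have hle : ∫ t, dilate h R (x - t) *
      (((F' : Set (EuclideanSpace ℝ (Fin d))) ∩ (t +ᵥ A)).ncard : ℝ) ≤ β * volume.real A := by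
    calc _ ≤ ∫ t, dilate h R (x - t) * (β * volume.real A) := by
          refine integral_mono (integral_dilate_mul_ncard hL.continuous hA hAb R F' x).1
            (hint.mul_const _) fun t => ?_
          refine mul_le_mul_of_nonneg_left ?_ (dilate_nonneg h0 hR0.le _)
          refine le_trans ?_ (hβ t)
          have hfin : (S ∩ (t +ᵥ A)).Finite := finite_of_isSeparated hr
            (hS.mono Set.inter_subset_left) ((hAb.vadd t).subset Set.inter_subset_right)
          exact Nat.cast_le.mpr (Set.ncard_le_ncard (Set.inter_subset_inter_left _ hF'S) hfin)
      _ = β * volume.real A := by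
          rw [integral_mul_const, integral_sub_left_eq_self (dilate h R) volume x,
            integral_dilate h hR0, h1, one_mul]
  have hle' := mul_le_mul_of_nonneg_left hle (inv_nonneg.mpr hV.le)
  have hcancel : (volume.real A)⁻¹ * (β * volume.real A) = β := by field_simp
  rw [hsum]
  linarith

/-- The lower counterpart of `sum_dilate_le`. The finite set `F` must now contain every point of `S`
that a window `t + A` with `‖x - t‖ < R` can see, that is, every point within `R + M` of `x`. -/
lemma le_sum_dilate {h : EuclideanSpace ℝ (Fin d) → ℝ} {L : ℝ≥0} (hL : LipschitzWith L h)
    (h0 : ∀ x, 0 ≤ h x) (hsupp : ∀ x, 1 ≤ ‖x‖ → h x = 0) (h1 : ∫ x, h x = 1)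
    {r : ℝ≥0} (hr : 0 < r) {A : Set (EuclideanSpace ℝ (Fin d))}
    (hA : MeasurableSet A) (hApos : 0 < volume A) {M : ℝ} (hM0 : 0 ≤ M) (hM : ∀ x ∈ A, ‖x‖ ≤ M)
    {S : Set (EuclideanSpace ℝ (Fin d))} (hS : IsSeparated r S) {α : ℝ}
    (hα : ∀ t : EuclideanSpace ℝ (Fin d), α * volume.real A ≤ ((S ∩ (t +ᵥ A)).ncard : ℝ)) :
    ∃ C : ℝ, 0 ≤ C ∧ ∀ R, 1 ≤ R → ∀ F : Finset (EuclideanSpace ℝ (Fin d)),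
      (F : Set (EuclideanSpace ℝ (Fin d))) ⊆ S → ∀ x,
        (∀ y ∈ S, ‖x - y‖ ≤ R + M → y ∈ F) → α - C / R ≤ ∑ y ∈ F, dilate h R (x - y) := by
  obtain ⟨C, hC0, hC⟩ := exists_abs_sum_dilate_sub_le hL hr hA hApos hM0 hM
  refine ⟨C, hC0, fun R hR F hFS x hxF => ?_⟩
  have hR0 : 0 < R := by linarith
  have hAb : Bornology.IsBounded A := isBounded_iff_forall_norm_le.mpr ⟨M, hM⟩
  have hV : 0 < volume.real A := ENNReal.toReal_pos hApos.ne' hAb.measure_lt_top.ne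
  set F' := F.filter fun y => ‖x - y‖ ≤ R + M with hF'
  have hsum : ∑ y ∈ F, dilate h R (x - y) = ∑ y ∈ F', dilate h R (x - y) := by
    refine (Finset.sum_filter_of_ne fun y _ hy => ?_).symm
    by_contra hlt
    exact hy (dilate_eq_zero hsupp hR0 (by linarith))
  have hF'S : (F' : Set (EuclideanSpace ℝ (Fin d))) ⊆ S := fun y hy =>
    hFS (Finset.mem_coe.mpr (Finset.mem_of_mem_filter y hy))
  have hb := (abs_le.mp (hC R hR F' (hS.mono hF'S) x fun y hy => (Finset.mem_filter.mp hy).2)).1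
  have hint : Integrable fun t => dilate h R (x - t) :=
    ((continuous_dilate hL.continuous R).integrable_of_hasCompactSupport
      (hasCompactSupport_dilate hsupp hR0)).comp_sub_left x
  have hle : α * volume.real A ≤ ∫ t, dilate h R (x - t) *
      (((F' : Set (EuclideanSpace ℝ (Fin d))) ∩ (t +ᵥ A)).ncard : ℝ) := by
    calc α * volume.real A = ∫ t, dilate h R (x - t) * (α * volume.real A) := by
          rw [integral_mul_const, integral_sub_left_eq_self (dilate h R) volume x,
            integral_dilate h hR0, h1, one_mul]
      _ ≤ _ := by
          refine integral_mono (hint.mul_const _)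
            (integral_dilate_mul_ncard hL.continuous hA hAb R F' x).1 fun t => ?_
          dsimp only
          rcases le_or_gt R ‖x - t‖ with ht | ht
          · simp [dilate_eq_zero hsupp hR0 ht]
          refine mul_le_mul_of_nonneg_left ((hα t).trans ?_) (dilate_nonneg h0 hR0.le _)
          have hsub : S ∩ (t +ᵥ A) ⊆ (F' : Set (EuclideanSpace ℝ (Fin d))) ∩ (t +ᵥ A) := by
            rintro y ⟨hyS, z, hz, rfl⟩
            have hn : ‖x - (t + z)‖ ≤ R + M := by
              rw [← sub_sub]
              exact (norm_sub_le _ _).trans (add_le_add ht.le (hM z hz))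
            exact ⟨Finset.mem_coe.mpr (Finset.mem_filter.mpr ⟨hxF _ hyS hn, hn⟩), z, hz, rfl⟩
          exact_mod_cast Set.ncard_le_ncard hsub (F'.finite_toSet.inter_of_left _)
  have hle' := mul_le_mul_of_nonneg_left hle (inv_nonneg.mpr hV.le)
  have hcancel : (volume.real A)⁻¹ * (α * volume.real A) = α := by field_simp
  rw [hsum]
  linarith

/-- Along a van Hove sequence only a negligible proportion of the points of a separated set lie
near the complement. -/
lemma IsVanHove.eventually_card_near_compl_le {B : ℕ → Set (EuclideanSpace ℝ (Fin d))}
    (hB : IsVanHove B) {r : ℝ≥0} (hr : 0 < r) (ρ : ℝ) {δ : ℝ} (hδ : 0 < δ) :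
    ∀ᶠ n in atTop, ∀ F : Finset (EuclideanSpace ℝ (Fin d)),
      IsSeparated r (F : Set (EuclideanSpace ℝ (Fin d))) →
      (∀ x ∈ F, x ∈ B n ∧ ∃ z, z ∉ B n ∧ ‖x - z‖ ≤ ρ) →
      (F.card : ℝ) ≤ δ * volume.real (B n) := by
  have hr0 : (0 : ℝ) < r := hr
  set v := volume (ball (0 : EuclideanSpace ℝ (Fin d)) (r / 2 : ℝ)) with hv
  have hvpos : 0 < v := volume_ball_half_pos hr
  have hvtop : v ≠ ⊤ := measure_ball_lt_top.ne
  set K : Set (EuclideanSpace ℝ (Fin d)) := closedBall 0 (max ρ 0 + r) with hK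
  have hpos : 0 < ENNReal.ofReal δ * v := by
    have := ENNReal.ofReal_pos.mpr hδ
    exact ENNReal.mul_pos this.ne' hvpos.ne'
  filter_upwards [(hB.tendsto_boundary K (isCompact_closedBall _ _)).eventually_lt_const hpos]
    with n hn F hF hFn
  have hsub : ∀ x ∈ F, ball x (r / 2 : ℝ) ⊆ vanHoveBoundary K (B n) := by
    intro x hx w hw
    obtain ⟨hxB, z, hz, hxz⟩ := hFn x hx
    rw [mem_ball, dist_eq_norm] at hw
    by_cases hwB : w ∈ B n
    · refine Or.inr ⟨⟨z, subset_closure hz, z - w, ?_, by simp⟩, hwB⟩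
      rw [hK, mem_closedBall, dist_zero_right]
      calc ‖z - w‖ = ‖(x - z) + (w - x)‖ := by rw [← norm_neg]; congr 1; abel
        _ ≤ ρ + r / 2 := (norm_add_le _ _).trans (add_le_add hxz hw.le)
        _ ≤ max ρ 0 + r := by
          have := le_max_left ρ 0
          linarith
    · refine Or.inl ⟨⟨x, hxB, w - x, ?_, by simp⟩, fun h => hwB (interior_subset h)⟩
      rw [hK, mem_closedBall, dist_zero_right]
      have := le_max_right ρ 0
      linarith
  have h1 := card_mul_volume_ball_le hF hsub
  have h2 : volume (vanHoveBoundary K (B n)) ≤ ENNReal.ofReal δ * v * volume (B n) :=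
    (ENNReal.div_le_iff (hB.volume_pos n).ne' (hB.volume_ne_top n)).mp hn.le
  have h3 : (F.card : ℝ≥0∞) ≤ ENNReal.ofReal δ * volume (B n) := by
    rw [← ENNReal.mul_le_mul_iff_left hvpos.ne' hvtop]
    calc _ ≤ _ := h1.trans h2
      _ = _ := by ring
  have h4 := ENNReal.toReal_mono (ENNReal.mul_ne_top ENNReal.ofReal_ne_top
    (hB.volume_ne_top n)) h3
  rwa [ENNReal.toReal_natCast, ENNReal.toReal_mul, ENNReal.toReal_ofReal hδ.le] at h4

/-! ### Almost trivial characters and the twisted double sum -/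

lemma norm_character (χ x : EuclideanSpace ℝ (Fin d)) : ‖character χ x‖ = 1 := by
  rw [character, Complex.norm_exp]
  simp

lemma neg_one_le_re_character (χ x : EuclideanSpace ℝ (Fin d)) : -1 ≤ (character χ x).re := by
  have := (abs_le.mp ((Complex.abs_re_le_norm (character χ x)))).1
  rwa [norm_character] at this

lemma le_re_character_of_mem_epsDual {S : Set (EuclideanSpace ℝ (Fin d))} {ε : ℝ}
    {χ x : EuclideanSpace ℝ (Fin d)} (hχ : χ ∈ epsDual S ε) (hx : x ∈ S) :
    1 - ε ≤ (character χ x).re := by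
  have h1 := (Complex.re_le_norm (1 - character χ x)).trans (hχ x hx)
  simp only [Complex.sub_re, Complex.one_re] at h1
  linarith

/-- One `η` serves at once as slack in `α`, slack in `β`, error of the character and final lower
bound. It exists by continuity, since at `η = 0` the right-hand side is `2α² - β² > 0`. -/
lemma exists_margin {α β : ℝ} (h : β ^ 2 < 2 * α ^ 2) (hα : 0 < α) :
    ∃ η : ℝ, 0 < η ∧ η < 1 ∧ η < α ∧ η ≤ (2 - η) * (α - η) * (α - η) - β * (β + η) := by
  have hcont : Continuous fun η : ℝ => (2 - η) * (α - η) * (α - η) - β * (β + η) - η := by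
    fun_prop
  have hlim : ∀ᶠ η in 𝓝[>] (0 : ℝ), 0 < (2 - η) * (α - η) * (α - η) - β * (β + η) - η :=
    (hcont.tendsto 0).mono_left nhdsWithin_le_nhds |>.eventually_const_lt (by nlinarith)
  obtain ⟨η, h1, h2⟩ := (hlim.and (Ioo_mem_nhdsGT (lt_min one_pos hα))).exists
  exact ⟨η, h2.1, h2.2.trans_le (min_le_left _ _), h2.2.trans_le (min_le_right _ _), by linarith⟩

/-- If `Λ ∩ Γ` carries more than the proportion `1 / √2` of the points of `Γ`, then the finite
autocorrelations of `Γ`, twisted by an almost trivial character on `Λ - Λ`, have large means. -/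
lemma exists_le_integral_dilate_mul_re_character
    {h : EuclideanSpace ℝ (Fin d) → ℝ} {L : ℝ≥0} (hL : LipschitzWith L h)
    (h0 : ∀ x, 0 ≤ h x) (hsupp : ∀ x, 1 ≤ ‖x‖ → h x = 0) (h1 : ∫ x, h x = 1)
    {B : ℕ → Set (EuclideanSpace ℝ (Fin d))} (hB : IsVanHove B)
    {Λ Γ : Set (EuclideanSpace ℝ (Fin d))} {r : ℝ≥0} (hr : 0 < r) (hΓ : IsSeparated r Γ)
    {α β : ℝ} (hα : 0 < α) (hβ : 0 < β) (hαβ : β ^ 2 < 2 * α ^ 2)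
    (hdens : ∀ᶠ n in atTop, ∀ x : EuclideanSpace ℝ (Fin d),
      α * volume.real (B n) ≤ ((Λ ∩ Γ ∩ (x +ᵥ B n)).ncard : ℝ) ∧
      ((Γ ∩ (x +ᵥ B n)).ncard : ℝ) ≤ β * volume.real (B n)) :
    ∃ η : ℝ, 0 < η ∧ ∃ R₀ : ℝ, 1 ≤ R₀ ∧ ∀ R, R₀ ≤ R → ∀ᶠ n in atTop,
      ∀ χ ∈ epsDual (Λ - Λ) η, η ≤ ∫ z, dilate h R z * (character χ z).re
        ∂(finiteAutocorrelation (diracComb Γ) (B n)) := by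
  classical
  obtain ⟨η, hη0, hη1, hηα, hη⟩ := exists_margin hαβ hα
  -- A single window `B m` is fixed here; it determines `M`, `C` and `C'`, hence the threshold for
  -- `R`, before `n` tends to infinity.
  obtain ⟨m, hm⟩ := hdens.exists
  have hΛΓ : IsSeparated r (Λ ∩ Γ) := hΓ.mono Set.inter_subset_right
  obtain ⟨M', hM'⟩ := (hB.isBounded m).exists_norm_le
  set M := max M' 0
  have hM : ∀ x ∈ B m, ‖x‖ ≤ M := fun x hx => (hM' x hx).trans (le_max_left M' 0)
  obtain ⟨C, hC0, hC⟩ := sum_dilate_le hL h0 hsupp h1 hr (hB.measurableSet m) (hB.volume_pos m)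
    (hB.isBounded m) hΓ fun t => (hm t).2
  obtain ⟨C', hC0', hC'⟩ := le_sum_dilate hL h0 hsupp h1 hr (hB.measurableSet m) (hB.volume_pos m)
    (le_max_right M' 0) hM hΛΓ fun t => (hm t).1
  refine ⟨η, hη0, max 1 (max (C / η) (C' / η)), le_max_left _ _, fun R hR => ?_⟩
  have hR1 : 1 ≤ R := (le_max_left _ _).trans hR
  have hR0 : 0 < R := by linarith
  have hCR : C / R ≤ η := by
    rw [div_le_iff₀ hR0, mul_comm, ← div_le_iff₀ hη0]
    exact ((le_max_left _ _).trans (le_max_right _ _)).trans hR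
  have hCR' : C' / R ≤ η := by
    rw [div_le_iff₀ hR0, mul_comm, ← div_le_iff₀ hη0]
    exact ((le_max_right _ _).trans (le_max_right _ _)).trans hR
  filter_upwards [hdens, hB.eventually_card_near_compl_le hr (R + M) hη0] with n hn hbd χ hχ
  have hfin : (Γ ∩ B n).Finite := finite_of_isSeparated hr (hΓ.mono Set.inter_subset_left)
    ((hB.isBounded n).subset Set.inter_subset_right)
  set F := hfin.toFinset with hF
  have hFc : (F : Set (EuclideanSpace ℝ (Fin d))) = Γ ∩ B n := by simp [hF]
  have hmemF : ∀ x, x ∈ F ↔ x ∈ Γ ∧ x ∈ B n := fun x => by simp [hF]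
  set G := F.filter fun x => x ∈ Λ with hG
  have hmemG : ∀ x, x ∈ G ↔ (x ∈ Γ ∧ x ∈ B n) ∧ x ∈ Λ := fun x => by simp [hG, hmemF]
  have hGc : (G : Set (EuclideanSpace ℝ (Fin d))) = Λ ∩ Γ ∩ B n := by
    ext x
    rw [Finset.mem_coe, hmemG]
    simp only [Set.mem_inter_iff]
    tauto
  have hVpos := hB.volume_real_pos n
  set V := volume.real (B n) with hV
  have hn0 := hn 0
  rw [zero_vadd, ← hFc, ← hGc, Set.ncard_coe_finset, Set.ncard_coe_finset] at hn0
  have hupper : ∑ x ∈ F, ∑ y ∈ F, dilate h R (x - y) ≤ β * V * (β + η) := by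
    calc _ ≤ ∑ _x ∈ F, (β + η) := Finset.sum_le_sum fun x _ =>
          (hC R hR1 F (hFc ▸ Set.inter_subset_left) x).trans (by linarith)
      _ = F.card * (β + η) := by rw [Finset.sum_const, nsmul_eq_mul]
      _ ≤ _ := by gcongr; exact hn0.2
  have hlower : (α - η) * V * (α - η) ≤ ∑ x ∈ G, ∑ y ∈ G, dilate h R (x - y) := by
    -- Points so deep inside `B n` that truncating to `B n` does not affect their inner sum. The van
    -- Hove property makes the remaining ones at most `η * V` in number.
    set D := G.filter fun x => ∀ z, ‖x - z‖ ≤ R + M → z ∈ B n with hD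
    have hcard : (α - η) * V ≤ D.card := by
      have h2 := hbd (G.filter fun x => ¬ ∀ z, ‖x - z‖ ≤ R + M → z ∈ B n)
        (hΓ.mono fun x hx => ((hmemG x).mp (Finset.mem_of_mem_filter x hx)).1.1) (by
          intro x hx
          obtain ⟨hxG, hx2⟩ := Finset.mem_filter.mp hx
          push Not at hx2
          obtain ⟨z, hz1, hz2⟩ := hx2
          exact ⟨((hmemG x).mp hxG).1.2, z, hz2, hz1⟩)
      have h3 : (D.card : ℝ) + (G.filter fun x => ¬ ∀ z, ‖x - z‖ ≤ R + M → z ∈ B n).card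
          = G.card := by
        exact_mod_cast Finset.card_filter_add_card_filter_not _
      linarith [hn0.1]
    have hin : ∀ x, 0 ≤ ∑ y ∈ G, dilate h R (x - y) := fun x =>
      Finset.sum_nonneg fun y _ => dilate_nonneg h0 hR0.le _
    calc _ ≤ D.card * (α - η) := by gcongr
      _ = ∑ _x ∈ D, (α - η) := by rw [Finset.sum_const, nsmul_eq_mul]
      _ ≤ ∑ x ∈ D, ∑ y ∈ G, dilate h R (x - y) := by
          refine Finset.sum_le_sum fun x hx => ?_
          obtain ⟨hxG, hx2⟩ := Finset.mem_filter.mp hx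
          refine le_trans (by linarith) (hC' R hR1 G (hGc ▸ Set.inter_subset_left) x ?_)
          intro y hy hxy
          exact (hmemG y).mpr ⟨⟨hy.2, hx2 y hxy⟩, hy.1⟩
      _ ≤ _ := Finset.sum_le_sum_of_subset_of_nonneg (Finset.filter_subset _ _)
          fun x _ _ => hin x
  -- Pairs in `G × G` contribute at least `(1 - η)` times the kernel and all others at least `-1`
  -- times; adding and subtracting the `G × G` sum turns `1 - η` into `2 - η`.
  have hsplit : (2 - η) * ∑ x ∈ G, ∑ y ∈ G, dilate h R (x - y)
      - ∑ x ∈ F, ∑ y ∈ F, dilate h R (x - y)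
      ≤ ∑ x ∈ F, ∑ y ∈ F, dilate h R (x - y) * (character χ (x - y)).re := by
    simp only [hG, Finset.sum_filter, Finset.mul_sum]
    rw [← Finset.sum_sub_distrib]
    refine Finset.sum_le_sum fun x _ => ?_
    have hterm : ∀ y, -dilate h R (x - y) ≤ dilate h R (x - y) * (character χ (x - y)).re :=
      fun y => by
        nlinarith [dilate_nonneg h0 hR0.le (x - y), neg_one_le_re_character χ (x - y)]
    split_ifs with hx
    · rw [Finset.mul_sum, ← Finset.sum_sub_distrib]
      refine Finset.sum_le_sum fun y _ => ?_
      split_ifs with hy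
      · nlinarith [dilate_nonneg h0 hR0.le (x - y),
          le_re_character_of_mem_epsDual hχ (Set.sub_mem_sub hx hy)]
      · simpa using hterm y
    · rw [mul_zero, zero_sub, ← Finset.sum_neg_distrib]
      exact Finset.sum_le_sum fun y _ => hterm y
  rw [integral_finiteAutocorrelation_diracComb (hB.measurableSet n) hFc, smul_eq_mul,
    ← div_eq_inv_mul, le_div_iff₀ hVpos]
  calc η * V ≤ ((2 - η) * (α - η) * (α - η) - β * (β + η)) * V := by gcongr
    _ = (2 - η) * ((α - η) * V * (α - η)) - β * V * (β + η) := by ring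
    _ ≤ (2 - η) * ∑ x ∈ G, ∑ y ∈ G, dilate h R (x - y)
      - ∑ x ∈ F, ∑ y ∈ F, dilate h R (x - y) := by
        gcongr
        linarith
    _ ≤ _ := hsplit

/-! ### Vague limits with uniform decay at infinity -/

/-- A continuous cutoff function, equal to `1` on the ball of radius `k` and to `0` outside the
ball of radius `k + 1`. -/
def cutoff (k : ℕ) (x : EuclideanSpace ℝ (Fin d)) : ℝ := max 0 (min 1 (k + 1 - ‖x‖))

lemma continuous_cutoff (k : ℕ) :
    Continuous (cutoff k : EuclideanSpace ℝ (Fin d) → ℝ) := by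
  unfold cutoff
  fun_prop

lemma cutoff_nonneg (k : ℕ) (x : EuclideanSpace ℝ (Fin d)) : 0 ≤ cutoff k x := le_max_left _ _

lemma cutoff_le_one (k : ℕ) (x : EuclideanSpace ℝ (Fin d)) : cutoff k x ≤ 1 :=
  max_le zero_le_one (min_le_left _ _)

lemma cutoff_eq_one {k : ℕ} {x : EuclideanSpace ℝ (Fin d)} (hx : ‖x‖ ≤ k) : cutoff k x = 1 := by
  rw [cutoff, min_eq_left (by linarith), max_eq_right zero_le_one]

lemma cutoff_eq_zero {k : ℕ} {x : EuclideanSpace ℝ (Fin d)} (hx : k + 1 ≤ ‖x‖) :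
    cutoff k x = 0 :=
  max_eq_left ((min_le_right _ _).trans (by linarith))

/-- Multiplication of a continuous function by `cutoff k`. -/
def cutoffMul (k : ℕ) (f : EuclideanSpace ℝ (Fin d) → ℝ) (hf : Continuous f) :
    C_c(EuclideanSpace ℝ (Fin d), ℝ) where
  toFun x := cutoff k x * f x
  continuous_toFun := (continuous_cutoff k).mul hf
  hasCompactSupport' := by
    refine HasCompactSupport.intro (isCompact_closedBall 0 (k + 1 : ℝ)) fun x hx => ?_
    simp only [mem_closedBall, dist_zero_right, not_le] at hx
    rw [cutoff_eq_zero hx.le, zero_mul]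

lemma cutoffMul_apply (k : ℕ) (f : EuclideanSpace ℝ (Fin d) → ℝ) (hf : Continuous f)
    (x : EuclideanSpace ℝ (Fin d)) : cutoffMul k f hf x = cutoff k x * f x := rfl

lemma integrable_weight_of_lintegral_le {μ : Measure (EuclideanSpace ℝ (Fin d))} {N : ℕ}
    {C : ℝ≥0} (h : ∫⁻ x, ENNReal.ofReal (weight N x) ∂μ ≤ C) : Integrable (weight N) μ := by
  refine ⟨(continuous_weight N).aestronglyMeasurable, ?_⟩
  rw [hasFiniteIntegral_iff_ofReal (ae_of_all _ fun x => (weight_pos N x).le)]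
  exact h.trans_lt ENNReal.coe_lt_top

lemma integral_weight_le_of_lintegral_le {μ : Measure (EuclideanSpace ℝ (Fin d))} {N : ℕ}
    {C : ℝ≥0} (h : ∫⁻ x, ENNReal.ofReal (weight N x) ∂μ ≤ C) : ∫ x, weight N x ∂μ ≤ C := by
  rw [integral_eq_lintegral_of_nonneg_ae (ae_of_all _ fun x => (weight_pos N x).le)
    (continuous_weight N).aestronglyMeasurable]
  exact ENNReal.toReal_le_coe_of_le_coe h

lemma hasTemperateGrowth_of_lintegral_weight_le {μ : Measure (EuclideanSpace ℝ (Fin d))} {N : ℕ}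
    {C : ℝ≥0} (h : ∫⁻ x, ENNReal.ofReal (weight N x) ∂μ ≤ C) : μ.HasTemperateGrowth := by
  refine ⟨N, (integrable_weight_of_lintegral_le h).congr (ae_of_all _ fun x => ?_)⟩
  simp [weight, Real.rpow_neg (show 0 ≤ 1 + ‖x‖ by positivity)]

lemma integrable_of_norm_le_weight {μ : Measure (EuclideanSpace ℝ (Fin d))} {N : ℕ}
    {C : ℝ≥0} (h : ∫⁻ x, ENNReal.ofReal (weight N x) ∂μ ≤ C) {G : Type*} [NormedAddCommGroup G]
    {f : EuclideanSpace ℝ (Fin d) → G} (hf : Continuous f) {K : ℝ}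
    (hK : ∀ x, ‖f x‖ ≤ K * weight N x) : Integrable f μ :=
  ((integrable_weight_of_lintegral_le h).const_mul K).mono'
    hf.aestronglyMeasurable (ae_of_all _ hK)

lemma weight_succ_le (N : ℕ) (x : EuclideanSpace ℝ (Fin d)) : weight (N + 1) x ≤ weight N x := by
  unfold weight
  gcongr
  · linarith [norm_nonneg x]
  · exact Nat.le_succ N

/-- The weight has no compact support, so the bound is passed to the limit for its truncations by
`cutoff k`, and then Fatou's lemma is applied as `k → ∞`. -/
lemma lintegral_weight_le_of_tendsto {U : Filter ℕ} [U.NeBot]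
    {μ : ℕ → Measure (EuclideanSpace ℝ (Fin d))} {μ' : Measure (EuclideanSpace ℝ (Fin d))}
    [IsFiniteMeasureOnCompacts μ']
    (hconv : ∀ f : C_c(EuclideanSpace ℝ (Fin d), ℝ),
      Tendsto (fun n => ∫ x, f x ∂(μ n)) U (𝓝 (∫ x, f x ∂μ')))
    {N : ℕ} {C : ℝ≥0} (hC : ∀ᶠ n in U, ∫⁻ x, ENNReal.ofReal (weight N x) ∂(μ n) ≤ C) :
    ∫⁻ x, ENNReal.ofReal (weight N x) ∂μ' ≤ C := by
  set g : ℕ → C_c(EuclideanSpace ℝ (Fin d), ℝ) := fun k =>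
    cutoffMul k (weight N) (continuous_weight N) with hg
  have hg0 : ∀ k x, 0 ≤ g k x := fun k x => mul_nonneg (cutoff_nonneg k x) (weight_pos N x).le
  have hgw : ∀ k x, g k x ≤ weight N x := fun k x =>
    mul_le_of_le_one_left (weight_pos N x).le (cutoff_le_one k x)
  have hk : ∀ k, ∫⁻ x, ENNReal.ofReal (g k x) ∂μ' ≤ C := by
    intro k
    have hint : Integrable (fun x => g k x) μ' :=
      (g k).continuous.integrable_of_hasCompactSupport (g k).hasCompactSupport
    rw [← ofReal_integral_eq_lintegral_ofReal hint (ae_of_all _ (hg0 k)), ← ENNReal.ofReal_coe_nnreal]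
    refine ENNReal.ofReal_le_ofReal (le_of_tendsto (hconv (g k)) ?_)
    filter_upwards [hC] with n hn
    exact (integral_mono_of_nonneg (ae_of_all _ (hg0 k)) (integrable_weight_of_lintegral_le hn)
      (ae_of_all _ (hgw k))).trans (integral_weight_le_of_lintegral_le hn)
  have hlim : ∀ x, liminf (fun k => ENNReal.ofReal (g k x)) atTop
      = ENNReal.ofReal (weight N x) := by
    intro x
    refine Tendsto.liminf_eq (tendsto_const_nhds.congr' ?_)
    filter_upwards [eventually_ge_atTop ⌈‖x‖⌉₊] with k hk
    rw [hg]
    dsimp only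
    rw [cutoffMul_apply, cutoff_eq_one (Nat.ceil_le.mp hk), one_mul]
  calc ∫⁻ x, ENNReal.ofReal (weight N x) ∂μ'
      = ∫⁻ x, liminf (fun k => ENNReal.ofReal (g k x)) atTop ∂μ' := by simp_rw [hlim]
    _ ≤ liminf (fun k => ∫⁻ x, ENNReal.ofReal (g k x) ∂μ') atTop :=
        lintegral_liminf_le fun k => (g k).continuous.measurable.ennreal_ofReal
    _ ≤ liminf (fun _ : ℕ => (C : ℝ≥0∞)) atTop := liminf_le_liminf (Eventually.of_forall hk)
    _ = C := by simp

/-- The one extra power of decay of `f` over the weight gains the factor `1 / (k + 1)` outside the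
ball of radius `k`. The resulting truncation error depends on `μ` only through `C`. -/
lemma dist_integral_cutoffMul_le {μ : Measure (EuclideanSpace ℝ (Fin d))} {N : ℕ} {C : ℝ≥0}
    (h : ∫⁻ x, ENNReal.ofReal (weight N x) ∂μ ≤ C) {f : EuclideanSpace ℝ (Fin d) → ℝ}
    (hf : Continuous f) {K : ℝ} (hK0 : 0 ≤ K) (hK : ∀ x, ‖f x‖ ≤ K * weight (N + 1) x) (k : ℕ) :
    dist (∫ x, f x ∂μ) (∫ x, cutoffMul k f hf x ∂μ) ≤ K * C / (k + 1) := by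
  have hfi : Integrable f μ := integrable_of_norm_le_weight h hf fun x =>
    (hK x).trans (mul_le_mul_of_nonneg_left (weight_succ_le N x) hK0)
  have hgi : Integrable (fun x => cutoffMul k f hf x) μ :=
    hfi.mono (cutoffMul k f hf).continuous.aestronglyMeasurable (ae_of_all _ fun x => by
      rw [cutoffMul_apply, norm_mul, Real.norm_of_nonneg (cutoff_nonneg k x)]
      exact mul_le_of_le_one_left (norm_nonneg _) (cutoff_le_one k x))
  rw [dist_eq_norm, ← integral_sub hfi hgi]
  have hb : ∀ x, ‖f x - cutoffMul k f hf x‖ ≤ K / (k + 1) * weight N x := by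
    intro x
    rcases le_or_gt ‖x‖ k with hx | hx
    · rw [cutoffMul_apply, cutoff_eq_one hx, one_mul, sub_self, norm_zero]
      have := weight_pos N x
      positivity
    · rw [cutoffMul_apply, ← one_sub_mul, norm_mul,
        Real.norm_of_nonneg (sub_nonneg.mpr (cutoff_le_one k x))]
      refine (mul_le_of_le_one_left (norm_nonneg _) (by linarith [cutoff_nonneg k x])).trans
        ((hK x).trans ?_)
      have h1 : weight (N + 1) x = (1 + ‖x‖)⁻¹ * weight N x := by
        rw [weight, weight, pow_succ, mul_inv, mul_comm]
      rw [h1, ← mul_assoc, div_eq_mul_inv]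
      have := (weight_pos N x).le
      rw [add_comm (k : ℝ)]
      gcongr
  calc _ ≤ ∫ x, K / (k + 1) * weight N x ∂μ :=
        norm_integral_le_of_norm_le ((integrable_weight_of_lintegral_le h).const_mul _)
          (ae_of_all _ hb)
    _ = K / (k + 1) * ∫ x, weight N x ∂μ := integral_const_mul _ _
    _ ≤ K / (k + 1) * C := by gcongr; exact integral_weight_le_of_lintegral_le h
    _ = _ := by ring

lemma tendsto_integral_real_of_decay {U : Filter ℕ} [U.NeBot]
    {μ : ℕ → Measure (EuclideanSpace ℝ (Fin d))} {μ' : Measure (EuclideanSpace ℝ (Fin d))}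
    [IsFiniteMeasureOnCompacts μ']
    (hconv : ∀ f : C_c(EuclideanSpace ℝ (Fin d), ℝ),
      Tendsto (fun n => ∫ x, f x ∂(μ n)) U (𝓝 (∫ x, f x ∂μ')))
    {N : ℕ} {C : ℝ≥0} (hC : ∀ᶠ n in U, ∫⁻ x, ENNReal.ofReal (weight N x) ∂(μ n) ≤ C)
    {f : EuclideanSpace ℝ (Fin d) → ℝ} (hf : Continuous f) {K : ℝ} (hK0 : 0 ≤ K)
    (hK : ∀ x, ‖f x‖ ≤ K * weight (N + 1) x) :
    Tendsto (fun n => ∫ x, f x ∂(μ n)) U (𝓝 (∫ x, f x ∂μ')) := by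
  have hC' := lintegral_weight_le_of_tendsto hconv hC
  rw [Metric.tendsto_nhds]
  intro ε hε
  obtain ⟨k, hk⟩ := exists_nat_gt (K * C / (ε / 3))
  have hk' : K * C / (k + 1) < ε / 3 := by
    rw [div_lt_iff₀ (by positivity)]
    rw [div_lt_iff₀ (by positivity)] at hk
    nlinarith
  filter_upwards [hC, (Metric.tendsto_nhds.mp (hconv (cutoffMul k f hf))) (ε / 3) (by positivity)]
    with n hn hn'
  have h1 := dist_integral_cutoffMul_le hn hf hK0 hK k
  have h2 := dist_integral_cutoffMul_le hC' hf hK0 hK k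
  rw [dist_comm] at h2
  have h3 := dist_triangle4 (∫ x, f x ∂(μ n)) (∫ x, cutoffMul k f hf x ∂(μ n))
    (∫ x, cutoffMul k f hf x ∂μ') (∫ x, f x ∂μ')
  linarith

/-- Vague convergence of measures with uniformly bounded weighted mass implies convergence of the
integrals of functions that decay faster than the weight. -/
lemma tendsto_integral_of_decay {U : Filter ℕ} [U.NeBot]
    {μ : ℕ → Measure (EuclideanSpace ℝ (Fin d))} {μ' : Measure (EuclideanSpace ℝ (Fin d))}
    [IsFiniteMeasureOnCompacts μ']
    (hconv : ∀ f : C_c(EuclideanSpace ℝ (Fin d), ℝ),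
      Tendsto (fun n => ∫ x, f x ∂(μ n)) U (𝓝 (∫ x, f x ∂μ')))
    {N : ℕ} {C : ℝ≥0} (hC : ∀ᶠ n in U, ∫⁻ x, ENNReal.ofReal (weight N x) ∂(μ n) ≤ C)
    {f : EuclideanSpace ℝ (Fin d) → ℂ} (hf : Continuous f) {K : ℝ} (hK0 : 0 ≤ K)
    (hK : ∀ x, ‖f x‖ ≤ K * weight (N + 1) x) :
    Tendsto (fun n => ∫ x, f x ∂(μ n)) U (𝓝 (∫ x, f x ∂μ')) := by
  have hC' := lintegral_weight_le_of_tendsto hconv hC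
  have hK' : ∀ x, ‖f x‖ ≤ K * weight N x := fun x =>
    (hK x).trans (mul_le_mul_of_nonneg_left (weight_succ_le N x) hK0)
  have hsplit : ∀ {m : Measure (EuclideanSpace ℝ (Fin d))},
      ∫⁻ x, ENNReal.ofReal (weight N x) ∂m ≤ C →
      ((∫ x, (f x).re ∂m : ℝ) : ℂ) + (∫ x, (f x).im ∂m : ℝ) * Complex.I = ∫ x, f x ∂m :=
    fun hm => integral_re_add_im (integrable_of_norm_le_weight hm hf hK')
  have hre := tendsto_integral_real_of_decay hconv hC (Complex.continuous_re.comp hf) hK0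
    fun x => (Complex.abs_re_le_norm (f x)).trans (hK x)
  have him := tendsto_integral_real_of_decay hconv hC (Complex.continuous_im.comp hf) hK0
    fun x => (Complex.abs_im_le_norm (f x)).trans (hK x)
  rw [← hsplit hC']
  refine (((Complex.continuous_ofReal.tendsto _).comp hre).add
    (((Complex.continuous_ofReal.tendsto _).comp him).mul_const Complex.I)).congr' ?_
  filter_upwards [hC] with n hn
  exact hsplit hn

lemma exists_norm_le_weight_of_hasCompactSupport {G : Type*} [NormedAddCommGroup G] (N : ℕ)
    {f : EuclideanSpace ℝ (Fin d) → G} (hf : Continuous f) (hs : HasCompactSupport f) :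
    ∃ K : ℝ, 0 ≤ K ∧ ∀ x, ‖f x‖ ≤ K * weight N x := by
  have hc : Continuous fun x => (1 + ‖x‖) ^ N * ‖f x‖ := by fun_prop
  obtain ⟨x₀, hx₀⟩ := hc.exists_forall_ge_of_hasCompactSupport hs.norm.mul_left
  refine ⟨(1 + ‖x₀‖) ^ N * ‖f x₀‖, by positivity, fun x => ?_⟩
  rw [weight, ← div_eq_mul_inv, le_div_iff₀ (by positivity), mul_comm]
  exact hx₀ x

lemma exists_norm_le_weight_schwartz (N : ℕ) (φ : 𝓢(EuclideanSpace ℝ (Fin d), ℂ)) :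
    ∃ K : ℝ, 0 ≤ K ∧ ∀ x, ‖φ x‖ ≤ K * weight N x := by
  refine ⟨2 ^ N * (Finset.Iic (N, 0)).sup (fun m => SchwartzMap.seminorm ℂ m.1 m.2) φ,
    by positivity, fun x => ?_⟩
  have h := SchwartzMap.one_add_le_sup_seminorm_apply (𝕜 := ℂ) (m := (N, 0)) le_rfl le_rfl φ x
  rw [norm_iteratedFDeriv_zero] at h
  rw [weight, ← div_eq_mul_inv, le_div_iff₀ (by positivity), mul_comm]
  exact h

/-- A family of measures with uniformly bounded weighted mass has a vague limit along every
ultrafilter. -/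
lemma exists_vague_limit (U : Ultrafilter ℕ) {μ : ℕ → Measure (EuclideanSpace ℝ (Fin d))}
    {N : ℕ} {C : ℝ≥0} (hC : ∀ᶠ n in U, ∫⁻ x, ENNReal.ofReal (weight N x) ∂(μ n) ≤ C) :
    ∃ ν : Measure (EuclideanSpace ℝ (Fin d)), IsFiniteMeasureOnCompacts ν ∧
      ∀ f : C_c(EuclideanSpace ℝ (Fin d), ℝ),
        Tendsto (fun n => ∫ x, f x ∂(μ n)) U (𝓝 (∫ x, f x ∂ν)) := by
  have hint : ∀ f : C_c(EuclideanSpace ℝ (Fin d), ℝ), ∀ᶠ n in U,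
      Integrable (fun x => f x) (μ n) := by
    intro f
    obtain ⟨K, -, hK⟩ := exists_norm_le_weight_of_hasCompactSupport N f.continuous
      f.hasCompactSupport
    filter_upwards [hC] with n hn using integrable_of_norm_le_weight hn f.continuous hK
  have hlim : ∀ f : C_c(EuclideanSpace ℝ (Fin d), ℝ), ∃ l : ℝ,
      Tendsto (fun n => ∫ x, f x ∂(μ n)) U (𝓝 l) := by
    intro f
    obtain ⟨K, hK0, hK⟩ := exists_norm_le_weight_of_hasCompactSupport N f.continuous
      f.hasCompactSupport
    have hmem : ∀ᶠ n in U, ∫ x, f x ∂(μ n) ∈ closedBall (0 : ℝ) (K * C) := by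
      filter_upwards [hC] with n hn
      rw [mem_closedBall, dist_zero_right]
      calc _ ≤ ∫ x, K * weight N x ∂(μ n) := norm_integral_le_of_norm_le
            ((integrable_weight_of_lintegral_le hn).const_mul K) (ae_of_all _ hK)
        _ = K * ∫ x, weight N x ∂(μ n) := integral_const_mul _ _
        _ ≤ K * C := by gcongr; exact integral_weight_le_of_lintegral_le hn
    -- A bounded real sequence converges along any ultrafilter, so no diagonal extraction over test
    -- functions is needed.
    obtain ⟨l, -, hl⟩ := (isCompact_closedBall (0 : ℝ) (K * C)).ultrafilter_le_nhds
      (U.map fun n => ∫ x, f x ∂(μ n)) (le_principal_iff.mpr hmem)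
    exact ⟨l, hl⟩
  choose l hl using hlim
  let L : C_c(EuclideanSpace ℝ (Fin d), ℝ) →ₗ[ℝ] ℝ :=
    { toFun := l
      map_add' := fun f g => tendsto_nhds_unique (hl (f + g)) (((hl f).add (hl g)).congr' (by
        filter_upwards [hint f, hint g] with n hf hg
        exact (integral_add hf hg).symm))
      map_smul' := fun c f => tendsto_nhds_unique (hl (c • f)) (((hl f).const_mul c).congr
        fun n => (integral_const_mul c _).symm) }
  -- The limits form a positive functional, which the Riesz–Markov–Kakutani theorem represents by a
  -- measure.
  let P : C_c(EuclideanSpace ℝ (Fin d), ℝ) →ₚ[ℝ] ℝ := PositiveLinearMap.mk₀ L fun f hf =>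
    ge_of_tendsto' (hl f) fun n => integral_nonneg hf
  refine ⟨RealRMK.rieszMeasure P, ?_, fun f => ?_⟩
  · infer_instance
  · rw [RealRMK.integral_rieszMeasure]
    exact hl f

/-! ### Uniform bounds for finite autocorrelations and their Fourier transforms -/

/-- The inner sums are bounded by separation and the number of outer terms per volume by packing.
This one quantity controls both the finite autocorrelations and their Fourier transforms. -/
lemma IsVanHove.exists_double_sum_weight_le {B : ℕ → Set (EuclideanSpace ℝ (Fin d))}
    (hB : IsVanHove B) {Γ : Set (EuclideanSpace ℝ (Fin d))} {r : ℝ≥0} (hr : 0 < r)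
    (hΓ : IsSeparated r Γ) {N : ℕ} (hN : d < N) :
    ∃ C : ℝ≥0, ∀ᶠ n in atTop, ∀ F : Finset (EuclideanSpace ℝ (Fin d)),
      (F : Set (EuclideanSpace ℝ (Fin d))) = Γ ∩ B n →
      (volume.real (B n))⁻¹ * ∑ x ∈ F, ∑ y ∈ F, weight N (x - y) ≤ C := by
  obtain ⟨C₁, hC₁0, hC₁⟩ := exists_sum_weight_le (d := d) hr hN
  obtain ⟨C₂, hC₂, hn⟩ := hB.eventually_relFrequency_le hr
  refine ⟨⟨C₂.toReal * C₁, by positivity⟩, hn.mono fun n hn F hF => ?_⟩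
  have hsep : IsSeparated r (F : Set (EuclideanSpace ℝ (Fin d))) :=
    hΓ.mono (hF ▸ Set.inter_subset_left)
  have h1 := hn Γ hΓ 0
  have hF0 : Γ ∩ ((0 : EuclideanSpace ℝ (Fin d)) +ᵥ B n) = F := by rw [zero_vadd, hF]
  rw [relFrequency_eq_ofReal (hB.volume_pos n) (hB.volume_ne_top n)
    (hF0 ▸ F.finite_toSet), hF0, Set.ncard_coe_finset, ENNReal.ofReal_le_iff_le_toReal hC₂] at h1
  have hV := hB.volume_real_pos n
  calc (volume.real (B n))⁻¹ * ∑ x ∈ F, ∑ y ∈ F, weight N (x - y)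
      ≤ (volume.real (B n))⁻¹ * ∑ _x ∈ F, C₁ := by
        gcongr with x _
        exact hC₁ F hsep x
    _ = F.card / volume.real (B n) * C₁ := by
        rw [Finset.sum_const, nsmul_eq_mul]
        ring
    _ ≤ C₂.toReal * C₁ := by gcongr

lemma lintegral_weight_finiteAutocorrelation_le {A S : Set (EuclideanSpace ℝ (Fin d))}
    (hA : MeasurableSet A) (hA0 : 0 < volume A) (hA' : volume A ≠ ⊤)
    {F : Finset (EuclideanSpace ℝ (Fin d))}
    (hF : (F : Set (EuclideanSpace ℝ (Fin d))) = S ∩ A) {N : ℕ} {C : ℝ≥0}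
    (hC : (volume.real A)⁻¹ * ∑ x ∈ F, ∑ y ∈ F, weight N (x - y) ≤ C) :
    ∫⁻ x, ENNReal.ofReal (weight N x) ∂(finiteAutocorrelation (diracComb S) A) ≤ C := by
  have hw : ∀ z : EuclideanSpace ℝ (Fin d), 0 ≤ weight N z := fun z => (weight_pos N z).le
  rw [lintegral_finiteAutocorrelation_diracComb hA hF]
  simp_rw [← ENNReal.ofReal_sum_of_nonneg fun y _ => hw (_ - y)]
  rw [← ENNReal.ofReal_sum_of_nonneg fun x _ => Finset.sum_nonneg fun y _ => hw (x - y),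
    ← ENNReal.ofReal_toReal hA', ← ENNReal.ofReal_inv_of_pos (ENNReal.toReal_pos hA0.ne' hA'),
    ← ENNReal.ofReal_mul (by positivity), ← ENNReal.ofReal_coe_nnreal]
  exact ENNReal.ofReal_le_ofReal hC

/-! ### Exponential sums as Fourier transforms of finite autocorrelations -/

lemma continuous_character (x : EuclideanSpace ℝ (Fin d)) : Continuous (character x) := by
  unfold character
  fun_prop

/-- From here on `character x k` is often read with `x` a point and `k` a frequency; the pairing is
symmetric. -/
lemma character_sub (x y k : EuclideanSpace ℝ (Fin d)) :
    character (x - y) k = character x k * starRingEnd ℂ (character y k) := by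
  rw [character, character, character, ← Complex.exp_conj, ← Complex.exp_add, inner_sub_right]
  congr 1
  simp only [map_mul, map_neg, Complex.conj_ofReal, Complex.conj_I, map_ofNat]
  push_cast
  ring

lemma character_add (x k t : EuclideanSpace ℝ (Fin d)) :
    character x (k + t) = character x k * character x t := by
  rw [character, character, character, ← Complex.exp_add, inner_add_left]
  congr 1
  push_cast
  ring

lemma fourier_eq_integral_character (φ : EuclideanSpace ℝ (Fin d) → ℂ)
    (w : EuclideanSpace ℝ (Fin d)) : 𝓕 φ w = ∫ v, character w v * φ v := by
  rw [Real.fourier_eq']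
  refine integral_congr_ae (ae_of_all _ fun v => ?_)
  dsimp only
  rw [smul_eq_mul, character]
  congr 2
  push_cast
  ring

/-- The normalized squared modulus `‖∑_{x ∈ F} e^{-2πi x·k}‖² / V` of an exponential sum. -/
def periodogram (F : Finset (EuclideanSpace ℝ (Fin d))) (V : ℝ)
    (k : EuclideanSpace ℝ (Fin d)) : ℝ :=
  V⁻¹ * ‖∑ x ∈ F, character x k‖ ^ 2

lemma periodogram_nonneg (F : Finset (EuclideanSpace ℝ (Fin d))) {V : ℝ} (hV : 0 < V)
    (k : EuclideanSpace ℝ (Fin d)) : 0 ≤ periodogram F V k := by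
  unfold periodogram
  positivity

lemma continuous_periodogram (F : Finset (EuclideanSpace ℝ (Fin d))) (V : ℝ) :
    Continuous (periodogram F V) := by
  unfold periodogram
  have := continuous_character (d := d)
  fun_prop

lemma ofReal_periodogram (F : Finset (EuclideanSpace ℝ (Fin d))) (V : ℝ)
    (k : EuclideanSpace ℝ (Fin d)) :
    (periodogram F V k : ℂ) = (V : ℂ)⁻¹ * ∑ x ∈ F, ∑ y ∈ F, character (x - y) k := by
  rw [periodogram]
  push_cast
  rw [← Complex.mul_conj', map_sum, Finset.sum_mul_sum]
  simp_rw [character_sub]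

/-- The absolutely continuous measure whose density is `periodogram F V`. -/
def periodogramMeasure (F : Finset (EuclideanSpace ℝ (Fin d))) (V : ℝ) :
    Measure (EuclideanSpace ℝ (Fin d)) :=
  volume.withDensity fun k => ENNReal.ofReal (periodogram F V k)

lemma integral_periodogramMeasure (F : Finset (EuclideanSpace ℝ (Fin d))) {V : ℝ} (hV : 0 < V)
    {φ : EuclideanSpace ℝ (Fin d) → ℂ} (hφ : Integrable φ) :
    ∫ k, φ k ∂(periodogramMeasure F V)
      = (V : ℂ)⁻¹ * ∑ x ∈ F, ∑ y ∈ F, ∫ k, character (x - y) k * φ k := by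
  have hint : ∀ z : EuclideanSpace ℝ (Fin d), Integrable fun k => character z k * φ k := fun z =>
    hφ.bdd_mul (continuous_character z).aestronglyMeasurable
      (ae_of_all _ fun k => (norm_character z k).le)
  rw [periodogramMeasure, integral_withDensity_eq_integral_toReal_smul
    (continuous_periodogram F V).measurable.ennreal_ofReal
    (ae_of_all _ fun _ => ENNReal.ofReal_lt_top)]
  calc _ = ∫ k, (V : ℂ)⁻¹ * ∑ x ∈ F, ∑ y ∈ F, character (x - y) k * φ k := by
        refine integral_congr_ae (ae_of_all _ fun k => ?_)
        dsimp only
        rw [ENNReal.toReal_ofReal (periodogram_nonneg F hV k), Complex.real_smul,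
          ofReal_periodogram, mul_assoc, Finset.sum_mul]
        simp_rw [Finset.sum_mul]
    _ = _ := by
        rw [integral_const_mul, integral_finsetSum _ fun x _ =>
          integrable_finsetSum _ fun y _ => hint _]
        simp_rw [integral_finsetSum _ fun y _ => hint (_ - y)]

lemma integrable_periodogramMeasure (F : Finset (EuclideanSpace ℝ (Fin d))) {V : ℝ} (hV : 0 < V)
    {φ : EuclideanSpace ℝ (Fin d) → ℝ} (hφ : Continuous φ) (hs : HasCompactSupport φ) :
    Integrable φ (periodogramMeasure F V) := by
  rw [periodogramMeasure, integrable_withDensity_iff_integrable_smul₀'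
    (continuous_periodogram F V).measurable.ennreal_ofReal.aemeasurable
    (ae_of_all _ fun _ => ENNReal.ofReal_lt_top)]
  refine Integrable.congr (f := fun k => periodogram F V k • φ k) ?_
    (ae_of_all _ fun k => by simp [ENNReal.toReal_ofReal (periodogram_nonneg F hV k)])
  exact ((continuous_periodogram F V).smul hφ).integrable_of_hasCompactSupport hs.smul_left

/-- Expanding the squared modulus gives the characters of all differences `x - y`, and integrating
each against `φ` evaluates `𝓕 φ` at that difference. -/
lemma integral_schwartz_periodogramMeasure {S A : Set (EuclideanSpace ℝ (Fin d))}
    (hA : MeasurableSet A) (hA0 : 0 < volume.real A) {F : Finset (EuclideanSpace ℝ (Fin d))}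
    (hF : (F : Set (EuclideanSpace ℝ (Fin d))) = S ∩ A) (φ : 𝓢(EuclideanSpace ℝ (Fin d), ℂ)) :
    ∫ k, φ k ∂(periodogramMeasure F (volume.real A))
      = ∫ x, (𝓕 φ) x ∂(finiteAutocorrelation (diracComb S) A) := by
  rw [integral_periodogramMeasure F hA0 φ.integrable,
    integral_finiteAutocorrelation_diracComb hA hF]
  simp_rw [SchwartzMap.fourier_coe, fourier_eq_integral_character]
  rw [Complex.real_smul, Complex.ofReal_inv]

/-- The weighted mass of a measure is controlled by the masses of the unit balls. -/
lemma exists_lintegral_weight_le {N : ℕ} (hN : d < N) :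
    ∃ K : ℝ≥0, ∀ (μ : Measure (EuclideanSpace ℝ (Fin d))) [SFinite μ] (C : ℝ≥0),
      (∀ t, μ (closedBall t 1) ≤ C) → ∫⁻ x, ENNReal.ofReal (weight N x) ∂μ ≤ K * C := by
  set I := ∫⁻ t : EuclideanSpace ℝ (Fin d), ENNReal.ofReal (weight N t) with hI
  have hItop : I ≠ ⊤ := by
    have h := (integrable_weight (d := d) hN).hasFiniteIntegral
    rw [hasFiniteIntegral_iff_ofReal (ae_of_all _ fun x => (weight_pos N x).le)] at h
    exact h.ne
  set v := volume (closedBall (0 : EuclideanSpace ℝ (Fin d)) 1) with hv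
  have hv0 : 0 < v := measure_closedBall_pos _ _ one_pos
  have hvtop : v ≠ ⊤ := measure_closedBall_lt_top.ne
  set c : ℝ≥0∞ := ENNReal.ofReal ((2 ^ N : ℝ)⁻¹) * v with hc
  have hc0 : c ≠ 0 := (ENNReal.mul_pos (ENNReal.ofReal_pos.mpr (by positivity)).ne' hv0.ne').ne'
  have hctop : c ≠ ⊤ := ENNReal.mul_ne_top ENNReal.ofReal_ne_top hvtop
  have hKtop : I / c ≠ ⊤ := ENNReal.div_ne_top hItop hc0
  refine ⟨(I / c).toNNReal, fun μ _ C hC => ?_⟩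
  rw [ENNReal.coe_toNNReal hKtop]
  have hwm : Measurable fun t : EuclideanSpace ℝ (Fin d) => ENNReal.ofReal (weight N t) :=
    (continuous_weight N).measurable.ennreal_ofReal
  have hm : Measurable fun p : EuclideanSpace ℝ (Fin d) × EuclideanSpace ℝ (Fin d) =>
      {q : EuclideanSpace ℝ (Fin d) × EuclideanSpace ℝ (Fin d) | dist q.1 q.2 ≤ 1}.indicator
        (fun q => ENNReal.ofReal (weight N q.2)) p :=
    (hwm.comp measurable_snd).indicator (isClosed_le continuous_dist continuous_const).measurableSet
  -- Within distance `1` the weight changes by a factor at most `2 ^ N`, so it is dominated by its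
  -- integral over a unit ball; Tonelli then brings in `μ (closedBall t 1)`.
  have hpoint : ∀ x : EuclideanSpace ℝ (Fin d), ENNReal.ofReal (weight N x) * c ≤
      ∫⁻ t, {q : EuclideanSpace ℝ (Fin d) × EuclideanSpace ℝ (Fin d) | dist q.1 q.2 ≤ 1}.indicator
        (fun q => ENNReal.ofReal (weight N q.2)) (x, t) := by
    intro x
    calc ENNReal.ofReal (weight N x) * c
        = ∫⁻ t in closedBall x 1, ENNReal.ofReal (weight N x * (2 ^ N : ℝ)⁻¹) := by
          rw [setLIntegral_const, Measure.addHaar_closedBall_center, ← hv, hc,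
            ENNReal.ofReal_mul (weight_pos N x).le, mul_assoc]
      _ ≤ ∫⁻ t in closedBall x 1, ENNReal.ofReal (weight N t) := by
          refine setLIntegral_mono hwm fun t ht => ENNReal.ofReal_le_ofReal ?_
          have h1 : ‖t‖ ≤ ‖x‖ + 1 := by
            rw [mem_closedBall, dist_eq_norm] at ht
            have := norm_le_norm_add_norm_sub x t
            rw [norm_sub_rev] at this
            linarith
          rw [weight, weight, ← mul_inv, ← mul_pow]
          gcongr
          linarith [norm_nonneg x]
      _ = _ := by
          rw [← lintegral_indicator measurableSet_closedBall]
          refine lintegral_congr fun t => ?_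
          simp only [Set.indicator, mem_closedBall, Set.mem_ofPred_eq, dist_comm]
  have hkey : (∫⁻ x, ENNReal.ofReal (weight N x) ∂μ) * c ≤ I * C := by
    calc _ = ∫⁻ x, ENNReal.ofReal (weight N x) * c ∂μ := (lintegral_mul_const _ hwm).symm
      _ ≤ ∫⁻ x, (∫⁻ t, {q : EuclideanSpace ℝ (Fin d) × EuclideanSpace ℝ (Fin d) |
            dist q.1 q.2 ≤ 1}.indicator (fun q => ENNReal.ofReal (weight N q.2)) (x, t)) ∂μ :=
          lintegral_mono hpoint
      _ = ∫⁻ t, ∫⁻ x, {q : EuclideanSpace ℝ (Fin d) × EuclideanSpace ℝ (Fin d) |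
            dist q.1 q.2 ≤ 1}.indicator (fun q => ENNReal.ofReal (weight N q.2)) (x, t) ∂μ :=
          lintegral_lintegral_swap hm.aemeasurable
      _ = ∫⁻ t, ENNReal.ofReal (weight N t) * μ (closedBall t 1) := by
          refine lintegral_congr fun t => ?_
          rw [← setLIntegral_const, ← lintegral_indicator measurableSet_closedBall]
          rfl
      _ ≤ ∫⁻ t, ENNReal.ofReal (weight N t) * C := by
          gcongr with t
          exact hC t
      _ = I * C := lintegral_mul_const _ hwm
  rw [mul_comm (I / c), ← mul_div_assoc, ENNReal.le_div_iff_mul_le (Or.inl hc0) (Or.inl hctop),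
    mul_comm (C : ℝ≥0∞)]
  exact hkey

lemma exists_schwartz_ge_indicator_closedBall :
    ∃ φ : 𝓢(EuclideanSpace ℝ (Fin d), ℂ), ∃ f : EuclideanSpace ℝ (Fin d) → ℝ,
      (∀ x, φ x = f x) ∧ Continuous f ∧ HasCompactSupport f ∧ (∀ x, 0 ≤ f x) ∧
      ∀ x ∈ closedBall (0 : EuclideanSpace ℝ (Fin d)) 1, f x = 1 := by
  let b : ContDiffBump (0 : EuclideanSpace ℝ (Fin d)) := ⟨1, 2, one_pos, one_lt_two⟩
  have h₁ : HasCompactSupport (fun x => ((b x : ℝ) : ℂ)) :=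
    b.hasCompactSupport.comp_left (g := fun y : ℝ => (y : ℂ)) Complex.ofReal_zero
  have h₂ : ContDiff ℝ ((⊤ : ℕ∞) : WithTop ℕ∞) (fun x => ((b x : ℝ) : ℂ)) := Complex.ofRealCLM.contDiff.comp b.contDiff
  exact ⟨h₁.toSchwartzMap h₂, b, fun x => rfl, b.continuous, b.hasCompactSupport,
    fun x => b.nonneg, fun x hx => b.one_of_mem_closedBall hx⟩

/-- The mass of the unit ball around `t` is at most the integral of a bump translated by `t`. On the
Fourier side the translation is only a unimodular factor, so the decay of the transformed bump
bounds this by the weighted double sum, uniformly in `t`. -/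
lemma exists_lintegral_weight_periodogramMeasure_le {N : ℕ} (hN : d < N) :
    ∃ K : ℝ≥0, ∀ (F : Finset (EuclideanSpace ℝ (Fin d))) (V : ℝ), 0 < V → ∀ C : ℝ≥0,
      V⁻¹ * ∑ x ∈ F, ∑ y ∈ F, weight N (x - y) ≤ C →
      ∫⁻ x, ENNReal.ofReal (weight N x) ∂(periodogramMeasure F V) ≤ (K * C : ℝ≥0) := by
  obtain ⟨φ, f, hφf, hfc, hfs, hf0, hf1⟩ := exists_schwartz_ge_indicator_closedBall (d := d)
  obtain ⟨K₁, hK₁⟩ := exists_lintegral_weight_le (d := d) hN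
  obtain ⟨K₂, hK₂0, hK₂⟩ := exists_norm_le_weight_schwartz N (𝓕 φ)
  lift K₂ to ℝ≥0 using hK₂0
  refine ⟨K₁ * K₂, fun F V hV C hC => ?_⟩
  have : SFinite (periodogramMeasure F V) := by
    unfold periodogramMeasure
    infer_instance
  refine (hK₁ (periodogramMeasure F V) (K₂ * C) fun t => ?_).trans_eq
    (by push_cast; ring)
  have hfct : Continuous fun k => f (k - t) := hfc.comp (continuous_sub_right t)
  have hfst : HasCompactSupport fun k => f (k - t) :=
    hfs.comp_homeomorph (Homeomorph.subRight t)
  have htrans : ∀ z : EuclideanSpace ℝ (Fin d),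
      ∫ k, character z k * (f (k - t) : ℂ) = character z t * (𝓕 φ) z := by
    intro z
    rw [SchwartzMap.fourier_coe, fourier_eq_integral_character, ← integral_const_mul,
      ← integral_sub_right_eq_self (fun k => character z t * (character z k * φ k)) t]
    refine integral_congr_ae (ae_of_all _ fun k => ?_)
    dsimp only
    rw [hφf, ← mul_assoc, mul_comm (character z t), ← character_add, sub_add_cancel]
  have hval : ∫ k, f (k - t) ∂(periodogramMeasure F V) ≤ K₂ * C := by
    calc _ ≤ ‖∫ k, f (k - t) ∂(periodogramMeasure F V)‖ := Real.le_norm_self _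
      _ = ‖∫ k, (f (k - t) : ℂ) ∂(periodogramMeasure F V)‖ := by
          rw [integral_complex_ofReal, Complex.norm_real]
      _ = ‖(V : ℂ)⁻¹ * ∑ x ∈ F, ∑ y ∈ F, character (x - y) t * (𝓕 φ) (x - y)‖ := by
          rw [integral_periodogramMeasure F hV (φ := fun k => ((f (k - t) : ℝ) : ℂ))
            (hfct.integrable_of_hasCompactSupport hfst).ofReal]
          simp_rw [htrans]
      _ ≤ V⁻¹ * ∑ x ∈ F, ∑ y ∈ F, K₂ * weight N (x - y) := by
          rw [norm_mul, norm_inv, Complex.norm_real, Real.norm_of_nonneg hV.le]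
          gcongr
          refine (norm_sum_le _ _).trans (Finset.sum_le_sum fun x _ => ?_)
          refine (norm_sum_le _ _).trans (Finset.sum_le_sum fun y _ => ?_)
          rw [norm_mul, norm_character, one_mul]
          exact hK₂ _
      _ = K₂ * (V⁻¹ * ∑ x ∈ F, ∑ y ∈ F, weight N (x - y)) := by
          simp_rw [← Finset.mul_sum]
          ring
      _ ≤ K₂ * C := by gcongr
  have hint : Integrable (fun k => f (k - t)) (periodogramMeasure F V) :=
    integrable_periodogramMeasure F hV hfct hfst
  calc periodogramMeasure F V (closedBall t 1)
      = ∫⁻ k in closedBall t 1, 1 ∂(periodogramMeasure F V) := by simp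
    _ ≤ ∫⁻ k in closedBall t 1, ENNReal.ofReal (f (k - t)) ∂(periodogramMeasure F V) := by
        refine setLIntegral_mono hfct.measurable.ennreal_ofReal fun k hk => ?_
        rw [hf1 (k - t) (by simpa [dist_eq_norm] using hk), ENNReal.ofReal_one]
    _ ≤ ∫⁻ k, ENNReal.ofReal (f (k - t)) ∂(periodogramMeasure F V) := setLIntegral_le_lintegral _ _
    _ = ENNReal.ofReal (∫ k, f (k - t) ∂(periodogramMeasure F V)) :=
        (ofReal_integral_eq_lintegral_ofReal hint (ae_of_all _ fun k => hf0 _)).symm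
    _ ≤ ENNReal.ofReal (K₂ * C) := ENNReal.ofReal_le_ofReal hval
    _ = ((K₂ * C : ℝ≥0) : ℝ≥0∞) := by
        rw [← ENNReal.ofReal_coe_nnreal, NNReal.coe_mul]

/-- Vague limits of the finite autocorrelations of a separated set are Fourier transformable, and
the Fourier transform is a positive measure. -/
lemma exists_isFourierTransform {B : ℕ → Set (EuclideanSpace ℝ (Fin d))} (hB : IsVanHove B)
    {Γ : Set (EuclideanSpace ℝ (Fin d))} {r : ℝ≥0} (hr : 0 < r) (hΓ : IsSeparated r Γ)
    {U : Ultrafilter ℕ} (hU : (U : Filter ℕ) ≤ atTop) {γ : Measure (EuclideanSpace ℝ (Fin d))}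
    [IsFiniteMeasureOnCompacts γ]
    (hconv : ∀ f : C_c(EuclideanSpace ℝ (Fin d), ℝ),
      Tendsto (fun n => ∫ x, f x ∂(finiteAutocorrelation (diracComb Γ) (B n))) U
        (𝓝 (∫ x, f x ∂γ))) :
    ∃ ν, IsFourierTransform γ ν := by
  have hfin : ∀ n, (Γ ∩ B n).Finite := fun n => finite_of_isSeparated hr
    (hΓ.mono Set.inter_subset_left) ((hB.isBounded n).subset Set.inter_subset_right)
  set F : ℕ → Finset (EuclideanSpace ℝ (Fin d)) := fun n => (hfin n).toFinset with hFdef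
  have hF : ∀ n, (F n : Set (EuclideanSpace ℝ (Fin d))) = Γ ∩ B n := fun n => by simp [hFdef]
  obtain ⟨C, hC⟩ := hB.exists_double_sum_weight_le hr hΓ (Nat.lt_succ_self d)
  obtain ⟨K, hK⟩ := exists_lintegral_weight_periodogramMeasure_le (d := d) (Nat.lt_succ_self d)
  have hCγ : ∀ᶠ n in U, ∫⁻ x, ENNReal.ofReal (weight (d + 1) x)
      ∂(finiteAutocorrelation (diracComb Γ) (B n)) ≤ C :=
    (hC.filter_mono hU).mono fun n hn => lintegral_weight_finiteAutocorrelation_le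
      (hB.measurableSet n) (hB.volume_pos n) (hB.volume_ne_top n) (hF n) (hn (F n) (hF n))
  have hCν : ∀ᶠ n in U, ∫⁻ x, ENNReal.ofReal (weight (d + 1) x)
      ∂(periodogramMeasure (F n) (volume.real (B n))) ≤ (K * C : ℝ≥0) :=
    (hC.filter_mono hU).mono fun n hn =>
      hK (F n) (volume.real (B n)) (hB.volume_real_pos n) C (hn (F n) (hF n))
  obtain ⟨ν, hνfin, hν⟩ := exists_vague_limit U hCν
  have hγT : γ.HasTemperateGrowth :=
    hasTemperateGrowth_of_lintegral_weight_le (lintegral_weight_le_of_tendsto hconv hCγ)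
  have hνT : ν.HasTemperateGrowth :=
    hasTemperateGrowth_of_lintegral_weight_le (lintegral_weight_le_of_tendsto hν hCν)
  refine ⟨ν, hγT, hνT, ?_⟩
  ext φ
  rw [TemperedDistribution.fourier_apply, Measure.toTemperedDistribution_apply γ,
    Measure.toTemperedDistribution_apply ν]
  -- The decay exponent is one more than that of the bounded weight `d + 1`, as
  -- `tendsto_integral_of_decay` requires.
  obtain ⟨K₁, hK₁0, hK₁⟩ := exists_norm_le_weight_schwartz (d + 1 + 1) φ
  obtain ⟨K₂, hK₂0, hK₂⟩ := exists_norm_le_weight_schwartz (d + 1 + 1) (𝓕 φ)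
  refine tendsto_nhds_unique
    (tendsto_integral_of_decay hconv hCγ (𝓕 φ).continuous hK₂0 hK₂) ?_
  refine (tendsto_integral_of_decay hν hCν φ.continuous hK₁0 hK₁).congr fun n => ?_
  exact integral_schwartz_periodogramMeasure (hB.measurableSet n) (hB.volume_real_pos n) (hF n) φ

/-! ### Atoms of the diffraction measure as means of the autocorrelation -/

lemma contDiff_dilate {h : EuclideanSpace ℝ (Fin d) → ℝ} {n : WithTop ℕ∞} (hh : ContDiff ℝ n h)
    (R : ℝ) : ContDiff ℝ n (dilate h R) := by
  unfold dilate
  fun_prop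

lemma contDiff_character (χ : EuclideanSpace ℝ (Fin d)) {n : WithTop ℕ∞} :
    ContDiff ℝ n (character χ) := by
  unfold character
  have h : ContDiff ℝ n fun x : EuclideanSpace ℝ (Fin d) => ((inner ℝ x χ : ℝ) : ℂ) :=
    Complex.ofRealCLM.contDiff.comp (contDiff_id.inner ℝ contDiff_const)
  exact (contDiff_const.mul h).cexp

/-- The character shifts the frequency by `χ`, and the `L¹` normalization cancels the Jacobian, so
contraction around `χ` leaves no factor depending on `R`. -/
lemma fourierInv_dilate_mul_character (h : EuclideanSpace ℝ (Fin d) → ℝ) {R : ℝ} (hR : 0 < R)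
    (χ k : EuclideanSpace ℝ (Fin d)) :
    𝓕⁻ (fun x => (dilate h R x : ℂ) * character χ x) k
      = 𝓕⁻ (fun x => (h x : ℂ)) (R • (k - χ)) := by
  rw [Real.fourierInv_eq', Real.fourierInv_eq']
  set G : EuclideanSpace ℝ (Fin d) → ℂ := fun u =>
    Complex.exp ((2 * Real.pi * inner ℝ u (R • (k - χ)) : ℝ) * Complex.I) • (h u : ℂ) with hG
  have h1 : ∀ v, Complex.exp ((2 * Real.pi * inner ℝ v k : ℝ) * Complex.I) •
      ((dilate h R v : ℂ) * character χ v) = ((R ^ d)⁻¹ : ℝ) • G (R⁻¹ • v) := by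
    intro v
    have h2 : inner ℝ (R⁻¹ • v) (R • (k - χ)) = inner ℝ v k - inner ℝ v χ := by
      rw [inner_smul_left, inner_smul_right, inner_sub_right]
      simp only [conj_trivial]
      field_simp
    have h3 : Complex.exp ((2 * Real.pi * (inner ℝ v k - inner ℝ v χ) : ℝ) * Complex.I)
        = Complex.exp ((2 * Real.pi * inner ℝ v k : ℝ) * Complex.I) * character χ v := by
      rw [character, ← Complex.exp_add]
      congr 1
      push_cast
      ring
    rw [hG]
    dsimp only
    rw [h2, h3, dilate, smul_eq_mul, smul_eq_mul, Complex.real_smul]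
    push_cast
    ring
  simp_rw [h1]
  rw [integral_smul, Measure.integral_comp_inv_smul_of_nonneg volume G hR.le, smul_smul]
  simp only [finrank_euclideanSpace, Fintype.card_fin]
  rw [inv_mul_cancel₀ (by positivity), one_smul]

/-- If `ν` is the Fourier transform of `γ` and `ν {χ} = 0`, then the means of `γ` twisted by the
character `χ` tend to `0`. -/
lemma IsFourierTransform.tendsto_integral_dilate_mul_character
    {γ ν : Measure (EuclideanSpace ℝ (Fin d))} (hγν : IsFourierTransform γ ν)
    {h : EuclideanSpace ℝ (Fin d) → ℝ} (hh : ContDiff ℝ ((⊤ : ℕ∞) : WithTop ℕ∞) h)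
    (hsupp : ∀ x, 1 ≤ ‖x‖ → h x = 0) {χ : EuclideanSpace ℝ (Fin d)} (hχ : ν {χ} = 0) :
    Tendsto (fun R => ∫ x, (dilate h R x : ℂ) * character χ x ∂γ) atTop (𝓝 0) := by
  obtain ⟨hγ, hν, hF⟩ := hγν
  have hhs : HasCompactSupport fun x => (h x : ℂ) := by
    refine HasCompactSupport.intro (isCompact_closedBall 0 1) fun x hx => ?_
    simp only [mem_closedBall, dist_zero_right, not_le] at hx
    rw [hsupp x hx.le, Complex.ofReal_zero]
  have hhd : ContDiff ℝ ((⊤ : ℕ∞) : WithTop ℕ∞) fun x => (h x : ℂ) :=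
    Complex.ofRealCLM.contDiff.comp hh
  set g : 𝓢(EuclideanSpace ℝ (Fin d), ℂ) := 𝓕⁻ (hhs.toSchwartzMap hhd) with hg
  have hkey : ∀ R, 0 < R → ∫ x, (dilate h R x : ℂ) * character χ x ∂γ
      = ∫ k, g (R • (k - χ)) ∂ν := by
    intro R hR
    have h₁ : HasCompactSupport fun x => (dilate h R x : ℂ) * character χ x :=
      ((hasCompactSupport_dilate hsupp hR).comp_left (g := fun y : ℝ => (y : ℂ))
        Complex.ofReal_zero).mul_right
    have h₂ : ContDiff ℝ ((⊤ : ℕ∞) : WithTop ℕ∞)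
        fun x => (dilate h R x : ℂ) * character χ x :=
      (Complex.ofRealCLM.contDiff.comp (contDiff_dilate hh R)).mul (contDiff_character χ)
    have h3 := DFunLike.congr_fun hF (𝓕⁻ (h₁.toSchwartzMap h₂))
    rw [TemperedDistribution.fourier_apply, Measure.toTemperedDistribution_apply γ,
      Measure.toTemperedDistribution_apply ν, FourierTransform.fourier_fourierInv_eq] at h3
    refine h3.trans (integral_congr_ae (ae_of_all _ fun k => ?_))
    dsimp only
    rw [hg, SchwartzMap.fourierInv_coe, SchwartzMap.fourierInv_coe]
    exact fourierInv_dilate_mul_character h hR χ k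
  refine Tendsto.congr' (f₁ := fun R => ∫ k, g (R • (k - χ)) ∂ν) ?_ ?_
  · filter_upwards [eventually_gt_atTop 0] with R hR using (hkey R hR).symm
  set N := ν.integrablePower with hN
  obtain ⟨K, hK0, hK⟩ := exists_norm_le_weight_schwartz N g
  obtain ⟨K₁, hK₁0, hK₁⟩ := exists_norm_le_weight_schwartz 1 g
  have hwint : Integrable (weight N) ν := by
    refine (Measure.integrable_pow_neg_integrablePower ν).congr (ae_of_all _ fun x => ?_)
    simp [weight, Real.rpow_neg (show 0 ≤ 1 + ‖x‖ by positivity), hN]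
  rw [← integral_zero (EuclideanSpace ℝ (Fin d)) ℂ (μ := ν)]
  -- For `R ≥ 1` one has `1 + ‖k‖ ≤ (1 + ‖χ‖) (1 + ‖R (k - χ)‖)`, which gives a dominating function
  -- independent of `R`. Pointwise convergence to `0` fails at most at `k = χ`, a null point by
  -- hypothesis.
  refine tendsto_integral_filter_of_dominated_convergence
    (fun k => K * (1 + ‖χ‖) ^ N * weight N k) ?_ ?_ (hwint.const_mul _) ?_
  · exact Eventually.of_forall fun R =>
      (g.continuous.comp (by fun_prop : Continuous fun k => R • (k - χ))).aestronglyMeasurable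
  · filter_upwards [eventually_ge_atTop 1] with R hR
    refine ae_of_all _ fun k => (hK _).trans ?_
    rw [mul_assoc]
    refine mul_le_mul_of_nonneg_left ?_ hK0
    rw [weight, weight, ← div_eq_mul_inv, le_div_iff₀ (by positivity),
      inv_mul_le_iff₀ (by positivity), ← mul_pow]
    gcongr
    have h1 : ‖k‖ ≤ ‖k - χ‖ + ‖χ‖ := by
      simpa using norm_add_le (k - χ) χ
    have h2 : ‖k - χ‖ ≤ ‖R • (k - χ)‖ := by
      rw [norm_smul, Real.norm_of_nonneg (by linarith)]
      exact le_mul_of_one_le_left (norm_nonneg _) hR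
    nlinarith [norm_nonneg χ, norm_nonneg (R • (k - χ))]
  · have hne : ∀ᵐ k ∂ν, k ≠ χ := by
      rw [ae_iff]
      simpa using hχ
    filter_upwards [hne] with k hk
    have hpos : 0 < ‖k - χ‖ := norm_pos_iff.mpr (sub_ne_zero.mpr hk)
    refine squeeze_zero_norm' (a := fun R : ℝ => K₁ * (1 + R * ‖k - χ‖)⁻¹) ?_ ?_
    · filter_upwards [eventually_gt_atTop 0] with R hR
      have h1 := hK₁ (R • (k - χ))
      rwa [weight, pow_one, norm_smul, Real.norm_of_nonneg hR.le] at h1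
    · rw [← mul_zero K₁]
      exact ((tendsto_atTop_add_const_left _ _
        (tendsto_id.atTop_mul_const hpos)).inv_tendsto_atTop).const_mul K₁

lemma exists_smooth_mean_kernel :
    ∃ h : EuclideanSpace ℝ (Fin d) → ℝ, ContDiff ℝ ((⊤ : ℕ∞) : WithTop ℕ∞) h ∧
      (∃ L : ℝ≥0, LipschitzWith L h) ∧ (∀ x, 0 ≤ h x) ∧ (∀ x, 1 ≤ ‖x‖ → h x = 0) ∧
      ∫ x, h x = 1 := by
  let b : ContDiffBump (0 : EuclideanSpace ℝ (Fin d)) := ⟨1 / 2, 1, by norm_num, by norm_num⟩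
  refine ⟨b.normed volume, b.contDiff_normed, ?_, b.nonneg_normed, fun x hx => ?_,
    b.integral_normed⟩
  · exact ContDiff.lipschitzWith_of_hasCompactSupport b.hasCompactSupport_normed
      (b.contDiff_normed (n := 1)) one_ne_zero
  · have hx' : x ∉ Function.support (b.normed volume) := by
      rw [b.support_normed_eq]
      simpa using hx
    exact Function.notMem_support.mp hx'

/-- The real part of a twisted mean of a vague limit is bounded below by bounds along the
approximating sequence. -/
lemma le_re_integral_dilate_mul_character {U : Filter ℕ} [U.NeBot]
    {μ : ℕ → Measure (EuclideanSpace ℝ (Fin d))} {γ : Measure (EuclideanSpace ℝ (Fin d))}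
    [IsFiniteMeasureOnCompacts γ]
    (hconv : ∀ f : C_c(EuclideanSpace ℝ (Fin d), ℝ),
      Tendsto (fun n => ∫ x, f x ∂(μ n)) U (𝓝 (∫ x, f x ∂γ)))
    {h : EuclideanSpace ℝ (Fin d) → ℝ} (hc : Continuous h) (hsupp : ∀ x, 1 ≤ ‖x‖ → h x = 0)
    {R : ℝ} (hR : 0 < R) {χ : EuclideanSpace ℝ (Fin d)} {η : ℝ}
    (hη : ∀ᶠ n in U, η ≤ ∫ z, dilate h R z * (character χ z).re ∂(μ n)) :
    η ≤ (∫ z, (dilate h R z : ℂ) * character χ z ∂γ).re := by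
  have hds := hasCompactSupport_dilate hsupp hR
  have hdc := continuous_dilate hc R
  let f : C_c(EuclideanSpace ℝ (Fin d), ℝ) :=
    { toFun := fun z => dilate h R z * (character χ z).re
      continuous_toFun := hdc.mul (Complex.continuous_re.comp (continuous_character χ))
      hasCompactSupport' := hds.mul_right }
  have hint : Integrable (fun z => (dilate h R z : ℂ) * character χ z) γ :=
    ((Complex.continuous_ofReal.comp hdc).mul
      (continuous_character χ)).integrable_of_hasCompactSupport
      ((hds.comp_left (g := fun y : ℝ => (y : ℂ)) Complex.ofReal_zero).mul_right)
  have hre : (∫ z, (dilate h R z : ℂ) * character χ z ∂γ).re = ∫ z, f z ∂γ := by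
    refine (integral_re hint).symm.trans (integral_congr_ae (ae_of_all _ fun z => ?_))
    exact Complex.re_ofReal_mul _ _
  rw [hre]
  exact ge_of_tendsto (hconv f) hη

end MeyerDiffraction

end

/-! ### The theorem -/

theorem theorem8p3 {d : ℕ}
    (B : ℕ → Set (EuclideanSpace ℝ (Fin d))) (hB : MeyerDiffraction.IsVanHove B)
    (Λ : Set (EuclideanSpace ℝ (Fin d))) (hΛ : MeyerDiffraction.IsMeyer Λ)
    (Γ : Delone.DeloneSet (EuclideanSpace ℝ (Fin d)))
    (hdens : (MeyerDiffraction.upperDensity B (symmDiff Λ (Γ : Set (EuclideanSpace ℝ (Fin d))))).toReal <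
      (√2 * (MeyerDiffraction.lowerDensity B Λ).toReal
        - (MeyerDiffraction.upperDensity B Λ).toReal) / (√2 + 1)) :
    ∃ ε : ℝ, 0 < ε ∧
      ∀ γ : MeasureTheory.Measure (EuclideanSpace ℝ (Fin d)),
        MeyerDiffraction.IsAutocorrelation B
          (MeyerDiffraction.diracComb (Γ : Set (EuclideanSpace ℝ (Fin d)))) γ →
        (∃ ν, MeyerDiffraction.IsFourierTransform γ ν) ∧
        ∀ ν, MeyerDiffraction.IsFourierTransform γ ν →
          MeyerDiffraction.epsDual (Λ - Λ) ε ⊆ MeyerDiffraction.braggSpectrum ν := by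
  obtain ⟨r, hr, hΛΛ⟩ := hΛ.uniformlyDiscrete_sub
  have hΓ : Metric.IsSeparated Γ.packingRadius (Γ : Set (EuclideanSpace ℝ (Fin d))) :=
    Γ.isSeparated_packingRadius
  have hpack := Γ.packingRadius_pos
  obtain ⟨α, β, hα, hβ, hαβ, hn⟩ :=
    MeyerDiffraction.exists_density_bounds hB hr (MeyerDiffraction.isSeparated_of_sub hΛΛ)
      hpack hΓ hdens
  obtain ⟨h, hh, ⟨L, hL⟩, h0, hsupp, h1⟩ := MeyerDiffraction.exists_smooth_mean_kernel (d := d)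
  obtain ⟨η, hη, R₀, hR₀, hmean⟩ :=
    MeyerDiffraction.exists_le_integral_dilate_mul_re_character hL h0 hsupp h1 hB hpack hΓ
      hα hβ hαβ hn
  -- The margin `η` was fixed before any autocorrelation was chosen, so it serves all of them.
  refine ⟨η, hη, fun γ hγ => ?_⟩
  have hfin := hγ.isFiniteMeasureOnCompacts
  -- An ultrafilter takes the place of a convergent subsequence; along the same one the Fourier
  -- transforms converge too.
  obtain ⟨U, hU, hlim⟩ := mapClusterPt_iff_ultrafilter.mp hγ.mapClusterPt
  rw [tendsto_pi_nhds] at hlim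
  refine ⟨MeyerDiffraction.exists_isFourierTransform hB hpack hΓ hU hlim,
    fun ν hν χ hχ hνχ => ?_⟩
  have hzero := hν.tendsto_integral_dilate_mul_character hh hsupp hνχ
  have hre := (Complex.continuous_re.tendsto 0).comp hzero
  -- The twisted means stay at least `η` for large `R`, yet tend to `0` if `χ` is not an atom of
  -- `ν`.
  have hle : η ≤ (0 : ℂ).re := by
    refine ge_of_tendsto hre ?_
    filter_upwards [eventually_ge_atTop R₀] with R hR
    exact MeyerDiffraction.le_re_integral_dilate_mul_character hlim hL.continuous hsupp
      (by linarith) (((hmean R hR).filter_mono hU).mono fun n hn => hn χ hχ)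
  exact absurd hle (not_le.mpr hη)
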